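/- Let $X, Y$ be complete metric spaces and let $E, F$ be nonzero (real or complex) Banach spaces. Let $U(X,E)$ denote the space of uniformly continuous functions from $X$ to $E$. A map $T\colon U(X,E)\to U(Y,F)$ is biseparating if it is a bijection and, for all $f,g,h\in U(X,E)$, $$\{f\ne h\}\cap\{g\neq h\}=\emptyset \iff \{Tf\ne Th\}\cap\{Tg\neq Th\}=\emptyset .$$ Write $X'$ for the set of accumulation points of $X$, and for $\varepsilon>0$ let $d_\varepsilon(a,b)\in[0,\infty]$ be the infimum of $\sum_{i=1}^n d(x_{i-1},x_i)$ over all finite chains $x_0=a,\dots,x_n=b$ with $d(x_{i-1},x_i)\le\varepsilon$ for all $i$ (with $\inf\emptyset=\infty$). A sequence $((x_n,e_n))$ in $X\times E$ is a $u$-sequence if $\inf_{m\ne n}d(x_m,x_n)>0$ and there are $\varepsilon>0$, $C<\infty$ with $\|e_n-e_m\|\le C\,d_\varepsilon(x_n,x_m)$ for all $m,n$. A function $\Xi\colon X\times E\to F$ is $u$-continuous if $\|\Xi(x_n,e_n)-\Xi(x_n',e_n')\|\to0$ whenever $((x_n,e_n))$ is a $u$-sequence and $((x_n',e_n'))$ is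 a sequence in $X\times E$ with $x_n'\neq x_n$ for all $n$ and $d(x_n,x_n')+\|e_n-e_n'\|\to0$. The same notions are used for $Y$, $F$. (a) If $T\colon U(X,E)\to U(Y,F)$ is biseparating, then there are a uniform homeomorphism $\varphi\colon X\to Y$ and functions $\Phi\colon Y\times E\to F$, $\Psi\colon X\times F\to E$ such that 1. for each $y\in Y$, $\Phi(y,\cdot)\colon E\to F$ is a bijection with inverse $\Psi(x,\cdot)$, where $\varphi(x)=y$; 2. $Tf(y)=\Phi(y,f(\varphi^{-1}(y)))$ and $T^{-1}g(x)=\Psi(x,g(\varphi(x)))$ for all $f\in U(X,E)$, $g\in U(Y,F)$, $x\in X$, $y\in Y$; 3. $\Phi$ is continuous at every point of $Y'\times E$ and $\Psi$ is continuous at every point of $X'\times F$; 4. $(x,e)\mapsto\Phi(\varphi(x),e)$ and $(y,e')\mapsto\Psi(\varphi^{-1}(y),e')$ are $u$-continuous. (b) Conversely, if a uniform homeomorphism $\varphi\colon X\to Y$ and functions $\Phi\colon Y\times E\to F$, $\Psi\colon X\times F\to E$ satisfy 1, 3 and 4, then $Tf(y)=\Phi(y,f(\varphi^{-1}(y)))$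 defines a biseparating map $T$ from $U(X,E)$ onto $U(Y,F)$. -/

import Mathlib

open Filter Topology
open scoped ENNReal NNReal

/-- `U(X,E)`: the set of uniformly continuous functions from `X` to `E`. -/
def UC (X E : Type*) [UniformSpace X] [UniformSpace E] : Set (X → E) :=
  {f | UniformContinuous f}

/-- `f` and `g` are disjoint with respect to `h`: the carriers `{x | f x - h x ≠ 0}` and
`{x | g x - h x ≠ 0}` do not meet. -/
def DisjointWrt {X E : Type*} [AddGroup E] (f g h : X → E) : Prop :=
  Disjoint (Function.support (f - h)) (Function.support (g - h))

/-- A map between spaces of vector-valued functions is biseparating if it is a bijection and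
`f`, `g` are disjoint with respect to `h` exactly when `T f`, `T g` are disjoint with respect
to `T h`. -/
structure IsBiseparating {X Y E F : Type*} [AddGroup E] [AddGroup F]
    {A : Set (X → E)} {B : Set (Y → F)} (T : A → B) : Prop where
  bijective : Function.Bijective T
  disjointWrt_iff : ∀ f g h : A,
    DisjointWrt (f : X → E) g h ↔ DisjointWrt (T f : Y → F) (T g) (T h)

/-- `d_ε(a,b)`: the infimum, in `[0,∞]`, of the lengths of all finite chains from `a` to `b`
whose steps have length at most `ε`; it is `∞` if there is no such chain. -/
noncomputable def chainDist {X : Type*} [PseudoMetricSpace X] (ε : ℝ) (a b : X) : ℝ≥0∞ :=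
  ⨅ (n : ℕ) (c : ℕ → X) (_ : c 0 = a ∧ c n = b ∧ ∀ i < n, dist (c i) (c (i + 1)) ≤ ε),
    ∑ i ∈ Finset.range n, edist (c i) (c (i + 1))

/-- A sequence is separated if `inf_{m ≠ n} d(x_m, x_n) > 0`. -/
def IsSeparatedSeq {X : Type*} [PseudoMetricSpace X] (x : ℕ → X) : Prop :=
  ∃ r : ℝ, 0 < r ∧ ∀ m n : ℕ, m ≠ n → r ≤ dist (x m) (x n)

/-- `((x_n, e_n))` is a `u`-sequence: `(x_n)` is separated and, for some `ε > 0` and `C < ∞`,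
`‖e_n - e_m‖ ≤ C d_ε(x_n, x_m)` for all `m, n`. -/
def IsUSeq {X E : Type*} [PseudoMetricSpace X] [SeminormedAddCommGroup E]
    (x : ℕ → X) (e : ℕ → E) : Prop :=
  IsSeparatedSeq x ∧ ∃ ε : ℝ, 0 < ε ∧ ∃ C : ℝ≥0, ∀ m n : ℕ,
    ENNReal.ofReal ‖e n - e m‖ ≤ (C : ℝ≥0∞) * chainDist ε (x n) (x m)

/-- `u`-continuity of a function `Ξ` on `X × E`. -/
def IsUContinuous {X E F : Type*} [PseudoMetricSpace X] [SeminormedAddCommGroup E]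
    [SeminormedAddCommGroup F] (Ξ : X × E → F) : Prop :=
  ∀ (x : ℕ → X) (e : ℕ → E), IsUSeq x e →
    ∀ (x' : ℕ → X) (e' : ℕ → E), (∀ n, x n ≠ x' n) →
      Tendsto (fun n => dist (x n) (x' n) + ‖e n - e' n‖) atTop (𝓝 0) →
        Tendsto (fun n => ‖Ξ (x n, e n) - Ξ (x' n, e' n)‖) atTop (𝓝 0)

/-- The conditions on the data `(φ, Φ, Ψ)` of the representation: each `Φ(y,·)` is a bijection
with inverse `Ψ(x,·)` where `φ(x) = y`; `Φ` and `Ψ` are continuous at each point whose first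
coordinate is an accumulation point of the base space; and both are `u`-continuous after the
base points are identified through `φ`. -/
structure IsUAdmissible {X Y E F : Type*} [MetricSpace X] [MetricSpace Y]
    [NormedAddCommGroup E] [NormedAddCommGroup F]
    (φ : X ≃ᵤ Y) (Φ : Y × E → F) (Ψ : X × F → E) : Prop where
  bijective : ∀ y : Y, Function.Bijective (fun e : E => Φ (y, e))
  leftInverse : ∀ (x : X) (y : Y), φ x = y → ∀ e : E, Ψ (x, Φ (y, e)) = e
  rightInverse : ∀ (x : X) (y : Y), φ x = y → ∀ e' : F, Φ (y, Ψ (x, e')) = e'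
  continuousAt : ∀ y ∈ derivedSet (Set.univ : Set Y), ∀ e : E, ContinuousAt Φ (y, e)
  continuousAt_inv : ∀ x ∈ derivedSet (Set.univ : Set X), ∀ e' : F, ContinuousAt Ψ (x, e')
  uContinuous : IsUContinuous (fun p : X × E => Φ (φ p.1, p.2))
  uContinuous_inv : IsUContinuous (fun p : Y × F => Ψ (φ.symm p.1, p.2))

/-! Everything rests on gluing: which mixtures of two uniformly continuous functions remain
uniformly continuous. By completeness, a sequence has a convergent or a separated subsequence, and
in either case there is room to mix. Along uniformly separated sets with bounded difference an
ordinary cut-off works (`exists_glue_of_dist`). Where a majorant `t` of the difference tends to `0`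
or `∞`, a cut-off depending on `log t` works, because its steepness is offset by the size of the
difference (`exists_glue_of_log`).

For (a), the open sets `{f ≠ h}` encode the topology of `X`. The crux is
`PreservesSeparation.ne_subset_closure`: the open set of `Y` matched to an open `V` does not depend,
up to closure, on the base function `h`. Hence `f` on `V` determines `T f` on `transport T V` and
conversely. The transports of balls shrinking to `x` shrink to one point `φ x`; otherwise a glued
function would have a preimage with two values at `x`. Interlacing two functions that agree at `x`
shows that `T f (φ x)` depends only on `f x`, so `Φ (y, e)` is the value at `y` of the image of the
constant `e`.

The regularity of `φ` and `Φ` is proved by contradiction, through test functions: a failure along a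
sequence is carried by one uniformly continuous function, built from bumps with heights tending to
`0` and, for `u`-continuity, from an interpolation along a `u`-sequence. Its image would then not be
uniformly continuous.

For (b), uniform continuity of `Φ (φ x, f x)` is tested on pairs of nearby points. Convergent
subsequences are handled by continuity at accumulation points. Separated ones are handled by
`u`-continuity, since uniformly continuous functions grow at most linearly along chains and so turn
separated sequences into `u`-sequences. -/

theorem exists_subseq_tendsto_or_separated {X : Type*} [PseudoMetricSpace X] [CompleteSpace X]
    (x : ℕ → X) :
    (∃ a, ∃ σ : ℕ → ℕ, StrictMono σ ∧ Tendsto (x ∘ σ) atTop (𝓝 a)) ∨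
      ∃ σ : ℕ → ℕ, StrictMono σ ∧ IsSeparatedSeq (x ∘ σ) := by
  by_cases h : TotallyBounded (Set.range x)
  · left
    have hc : IsCompact (closure (Set.range x)) :=
      isCompact_iff_totallyBounded_isComplete.2 ⟨h.closure, isClosed_closure.isComplete⟩
    obtain ⟨a, -, σ, hσ, hlim⟩ := hc.tendsto_subseq fun n => subset_closure (Set.mem_range_self n)
    exact ⟨a, σ, hσ, hlim⟩
  · right
    rw [Metric.totallyBounded_iff] at h
    push Not at h
    obtain ⟨ε, hε, h⟩ := h
    obtain ⟨σ, -, hσ⟩ := exists_seq_of_forall_finset_exists (fun _ : ℕ => True)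
      (fun m n => m < n ∧ ε ≤ dist (x m) (x n)) (by
        intro s _
        have hfin : (x '' (Finset.range (s.sup id + 1) : Set ℕ)).Finite :=
          (Finset.finite_toSet _).image _
        obtain ⟨_, ⟨n, rfl⟩, hn⟩ := Set.not_subset.1 (h _ hfin)
        refine ⟨n, trivial, fun m hm => ?_⟩
        have hms : m ≤ s.sup id := Finset.le_sup (f := id) hm
        simp only [Set.mem_iUnion, Metric.mem_ball, not_exists, not_lt, Set.mem_image,
          Finset.mem_coe, Finset.mem_range] at hn
        constructor
        · by_contra hle
          have := hn (x n) ⟨n, by omega, rfl⟩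
          rw [dist_self] at this
          linarith
        · rw [dist_comm]
          exact hn (x m) ⟨m, by omega, rfl⟩)
    refine ⟨σ, fun m n hmn => (hσ m n hmn).1, ε, hε, fun m n hmn => ?_⟩
    rcases lt_or_gt_of_ne hmn with h1 | h1
    · exact (hσ m n h1).2
    · rw [dist_comm]; exact (hσ n m h1).2

theorem IsSeparatedSeq.comp_strictMono {X : Type*} [PseudoMetricSpace X] {x : ℕ → X}
    (h : IsSeparatedSeq x) {σ : ℕ → ℕ} (hσ : StrictMono σ) : IsSeparatedSeq (x ∘ σ) := by
  obtain ⟨r, hr, h⟩ := h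
  exact ⟨r, hr, fun m n hmn => h _ _ (hσ.injective.ne hmn)⟩

/-! ### Gluing and interlacing uniformly continuous functions. -/

section Glue

variable {X E : Type*} [PseudoMetricSpace X] [NormedAddCommGroup E] [NormedSpace ℝ E]

/-- The difference is split so that the change of `q` multiplies the shorter of the two vectors.
Thus `q` itself need not be uniformly continuous where `u` is small. -/
theorem uniformContinuous_smul_of_min {q : X → ℝ} {u : X → E} (hq : ∀ z, |q z| ≤ 1)
    (hu : UniformContinuous u)
    (h : ∀ ε > 0, ∃ δ > 0, ∀ z z', dist z z' < δ → |q z - q z'| * min ‖u z‖ ‖u z'‖ < ε) :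
    UniformContinuous fun z => q z • u z := by
  rw [Metric.uniformContinuous_iff] at hu ⊢
  intro ε hε
  obtain ⟨δ₁, hδ₁, h1⟩ := hu (ε / 2) (by positivity)
  obtain ⟨δ₂, hδ₂, h2⟩ := h (ε / 2) (by positivity)
  refine ⟨min δ₁ δ₂, lt_min hδ₁ hδ₂, fun {z z'} hz => ?_⟩
  have h1 := h1 (lt_of_lt_of_le hz (min_le_left _ _))
  have h2 := h2 z z' (lt_of_lt_of_le hz (min_le_right _ _))
  rw [dist_eq_norm] at h1 ⊢
  rcases le_total ‖u z‖ ‖u z'‖ with hle | hle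
  · rw [min_eq_left hle] at h2
    have e : q z • u z - q z' • u z' = (q z - q z') • u z + q z' • (u z - u z') := by
      rw [sub_smul, smul_sub]; abel
    have a1 : ‖(q z - q z') • u z‖ = |q z - q z'| * ‖u z‖ := by rw [norm_smul, Real.norm_eq_abs]
    have a2 : ‖q z' • (u z - u z')‖ ≤ 1 * ‖u z - u z'‖ := by
      rw [norm_smul, Real.norm_eq_abs]
      exact mul_le_mul_of_nonneg_right (hq z') (norm_nonneg _)
    rw [e]
    linarith [norm_add_le ((q z - q z') • u z) (q z' • (u z - u z'))]
  · rw [min_eq_right hle] at h2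
    have e : q z • u z - q z' • u z' = (q z - q z') • u z' + q z • (u z - u z') := by
      rw [sub_smul, smul_sub]; abel
    have a1 : ‖(q z - q z') • u z'‖ = |q z - q z'| * ‖u z'‖ := by
      rw [norm_smul, Real.norm_eq_abs]
    have a2 : ‖q z • (u z - u z')‖ ≤ 1 * ‖u z - u z'‖ := by
      rw [norm_smul, Real.norm_eq_abs]
      exact mul_le_mul_of_nonneg_right (hq z) (norm_nonneg _)
    rw [e]
    linarith [norm_add_le ((q z - q z') • u z') (q z • (u z - u z'))]

/-- The piecewise linear function equal to `1` up to `1` and to `0` from `2` on. -/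
noncomputable def ramp (s : ℝ) : ℝ := max 0 (min 1 (2 - s))

theorem ramp_nonneg (s : ℝ) : 0 ≤ ramp s := le_max_left _ _

theorem ramp_le_one (s : ℝ) : ramp s ≤ 1 := max_le zero_le_one (min_le_left _ _)

theorem abs_ramp_le (s : ℝ) : |ramp s| ≤ 1 := by
  rw [abs_of_nonneg (ramp_nonneg s)]; exact ramp_le_one s

theorem ramp_eq_one {s : ℝ} (h : s ≤ 1) : ramp s = 1 := by
  rw [ramp, min_eq_left (by linarith), max_eq_right zero_le_one]

theorem ramp_eq_zero {s : ℝ} (h : 2 ≤ s) : ramp s = 0 := by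
  rw [ramp, max_eq_left]
  exact (min_le_right _ _).trans (by linarith)

theorem abs_ramp_sub_le (s s' : ℝ) : |ramp s - ramp s'| ≤ |s - s'| := by
  unfold ramp
  calc |max 0 (min 1 (2 - s)) - max 0 (min 1 (2 - s'))|
      ≤ |min 1 (2 - s) - min 1 (2 - s')| := by
        simpa using abs_max_sub_max_le_max (0 : ℝ) (min 1 (2 - s)) 0 (min 1 (2 - s'))
    _ ≤ |(2 - s) - (2 - s')| := by
        simpa using abs_min_sub_min_le_max (1 : ℝ) (2 - s) 1 (2 - s')
    _ = |s - s'| := by rw [abs_sub_comm s s']; congr 1; ring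

/-- Two uniformly continuous functions can be glued along uniformly separated sets, provided
their difference is bounded on one of them. -/
theorem exists_glue_of_dist {k₁ k₂ : X → E} (h₁ : UniformContinuous k₁)
    (h₂ : UniformContinuous k₂) {A B : Set X} {r : ℝ} (hr : 0 < r)
    (hAB : ∀ a ∈ A, ∀ b ∈ B, r ≤ dist a b) {M : ℝ} (hM : ∀ a ∈ A, ‖k₁ a - k₂ a‖ ≤ M) :
    ∃ g : X → E, UniformContinuous g ∧ (∀ a ∈ A, ∀ᶠ z in 𝓝 a, g z = k₁ z) ∧
      (∀ b ∈ B, ∀ᶠ z in 𝓝 b, g z = k₂ z) := by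
  rcases A.eq_empty_or_nonempty with rfl | hA
  · exact ⟨k₂, h₂, by simp, fun b _ => Eventually.of_forall fun _ => rfl⟩
  have hM0 : 0 ≤ M := by
    obtain ⟨a, ha⟩ := hA
    exact (norm_nonneg _).trans (hM a ha)
  set u : X → E := fun z => k₁ z - k₂ z with hu_def
  have hu : UniformContinuous u := h₁.sub h₂
  -- The first factor is `1` near `A` and, since the factor `3 / r` makes its argument at least `3`,
  -- vanishes near `B`. The second cuts off where `‖u‖ ≥ M + 2`, so only bounded values of `u` are
  -- multiplied.
  set q : X → ℝ := fun z => ramp (3 / r * Metric.infDist z A) * ramp (‖u z‖ - M) with hq_def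
  have hq0 : ∀ z, 0 ≤ q z := fun z => mul_nonneg (ramp_nonneg _) (ramp_nonneg _)
  have hq1 : ∀ z, q z ≤ 1 := fun z => mul_le_one₀ (ramp_le_one _) (ramp_nonneg _) (ramp_le_one _)
  have hqsub : ∀ z z', |q z - q z'| ≤ 3 / r * dist z z' + ‖u z - u z'‖ := by
    intro z z'
    have e : q z - q z' = (ramp (3 / r * Metric.infDist z A) - ramp (3 / r * Metric.infDist z' A))
        * ramp (‖u z‖ - M) + ramp (3 / r * Metric.infDist z' A) *
          (ramp (‖u z‖ - M) - ramp (‖u z'‖ - M)) := by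
      simp only [hq_def]; ring
    rw [e]
    refine (abs_add_le _ _).trans (add_le_add ?_ ?_)
    · rw [abs_mul]
      refine (mul_le_of_le_one_right (abs_nonneg _) (abs_ramp_le _)).trans
        ((abs_ramp_sub_le _ _).trans ?_)
      rw [← mul_sub, abs_mul, abs_of_pos (by positivity : 0 < 3 / r)]
      refine mul_le_mul_of_nonneg_left ?_ (by positivity)
      have := (Metric.lipschitz_infDist_pt A).dist_le_mul z z'
      rwa [NNReal.coe_one, one_mul, Real.dist_eq] at this
    · rw [abs_mul]
      refine (mul_le_of_le_one_left (abs_nonneg _) (abs_ramp_le _)).trans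
        ((abs_ramp_sub_le _ _).trans ?_)
      rw [sub_sub_sub_cancel_right]
      exact abs_norm_sub_norm_le _ _
  have hsm : UniformContinuous fun z => q z • u z := by
    refine uniformContinuous_smul_of_min
      (fun z => by rw [abs_of_nonneg (hq0 z)]; exact hq1 z) hu ?_
    intro ε hε
    obtain ⟨δ, hδ, hd⟩ := Metric.uniformContinuous_iff.1 hu (ε / (2 * (M + 2))) (by positivity)
    refine ⟨min δ (r / 3 * (ε / (2 * (M + 2)))), by positivity, fun z z' hz => ?_⟩
    have h1 := hd (lt_of_lt_of_le hz (min_le_left _ _))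
    have h2 := lt_of_lt_of_le hz (min_le_right _ _)
    rw [dist_eq_norm] at h1
    by_cases hmin : min ‖u z‖ ‖u z'‖ ≤ M + 2
    · have h3 : 3 / r * dist z z' < ε / (2 * (M + 2)) := by
        calc 3 / r * dist z z' < 3 / r * (r / 3 * (ε / (2 * (M + 2)))) :=
              mul_lt_mul_of_pos_left h2 (by positivity)
          _ = _ := by field_simp
      have h4 : |q z - q z'| < ε / (M + 2) := by
        have : ε / (M + 2) = ε / (2 * (M + 2)) + ε / (2 * (M + 2)) := by field_simp; ring
        linarith [hqsub z z']
      calc |q z - q z'| * min ‖u z‖ ‖u z'‖ ≤ |q z - q z'| * (M + 2) :=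
            mul_le_mul_of_nonneg_left hmin (abs_nonneg _)
        _ < ε / (M + 2) * (M + 2) := mul_lt_mul_of_pos_right h4 (by positivity)
        _ = ε := by field_simp
    · rw [not_le, lt_min_iff] at hmin
      have e1 : q z = 0 := by
        simp only [hq_def]; rw [ramp_eq_zero (s := ‖u z‖ - M) (by linarith), mul_zero]
      have e2 : q z' = 0 := by
        simp only [hq_def]; rw [ramp_eq_zero (s := ‖u z'‖ - M) (by linarith), mul_zero]
      simpa [e1, e2] using hε
  refine ⟨fun z => k₂ z + q z • u z, h₂.add hsm, fun a ha => ?_, fun b hb => ?_⟩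
  · have c1 : ∀ᶠ z in 𝓝 a, 3 / r * Metric.infDist z A < 1 := by
      refine ContinuousAt.eventually_lt (f := fun z => 3 / r * Metric.infDist z A)
        (g := fun _ => (1 : ℝ)) ?_ continuousAt_const ?_
      · exact (continuous_const.mul (Metric.continuous_infDist_pt A)).continuousAt
      · simp [Metric.infDist_zero_of_mem ha]
    have c2 : ∀ᶠ z in 𝓝 a, ‖u z‖ < M + 1 :=
      hu.continuous.norm.continuousAt.eventually_lt continuousAt_const
        (by have := hM a ha; simp only [hu_def]; linarith)
    filter_upwards [c1, c2] with z hz1 hz2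
    simp only [hq_def]
    rw [ramp_eq_one hz1.le, ramp_eq_one (by linarith)]
    simp [hu_def]
  · have c1 : ∀ᶠ z in 𝓝 b, 2 < 3 / r * Metric.infDist z A := by
      refine ContinuousAt.eventually_lt (f := fun _ => (2 : ℝ)) continuousAt_const
        (g := fun z => 3 / r * Metric.infDist z A)
        (continuous_const.mul (Metric.continuous_infDist_pt A)).continuousAt ?_
      have : r ≤ Metric.infDist b A :=
        (Metric.le_infDist hA).2 fun a ha => by rw [dist_comm]; exact hAB a ha b hb
      calc (2 : ℝ) < 3 / r * r := by field_simp; norm_num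
        _ ≤ _ := mul_le_mul_of_nonneg_left this (by positivity)
    filter_upwards [c1] with z hz
    simp only [hq_def]
    rw [ramp_eq_zero hz.le]
    simp

/-- Follows from `log s ≤ s - 1`. It makes a Lipschitz function of `log t` harmless once multiplied
by vectors of norm at most `t`. -/
theorem mul_abs_log_sub_le {a b : ℝ} (ha : 0 < a) (hab : a ≤ b) :
    |Real.log a - Real.log b| * a ≤ b - a := by
  have hb : 0 < b := ha.trans_le hab
  rw [abs_sub_comm, abs_of_nonneg (sub_nonneg.2 (Real.log_le_log ha hab)),
    ← Real.log_div hb.ne' ha.ne']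
  calc Real.log (b / a) * a ≤ (b / a - 1) * a :=
        mul_le_mul_of_nonneg_right (Real.log_le_sub_one_of_pos (by positivity)) ha.le
    _ = b - a := by field_simp

/-- Two uniformly continuous functions can be glued along sets on which a uniformly continuous
majorant of their difference takes logarithmically separated values. -/
theorem exists_glue_of_log {k₁ k₂ : X → E} (h₁ : UniformContinuous k₁)
    (h₂ : UniformContinuous k₂) {t : X → ℝ} (ht : UniformContinuous t)
    (hle : ∀ z, ‖k₁ z - k₂ z‖ ≤ t z) {A B : Set X} {r : ℝ} (hr : 0 < r)
    (hA : ∀ a ∈ A, 0 < t a) (hB : ∀ b ∈ B, 0 < t b)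
    (hAB : ∀ a ∈ A, ∀ b ∈ B, r ≤ |Real.log (t a) - Real.log (t b)|) :
    ∃ g : X → E, UniformContinuous g ∧ (∀ a ∈ A, ∀ᶠ z in 𝓝 a, g z = k₁ z) ∧
      (∀ b ∈ B, ∀ᶠ z in 𝓝 b, g z = k₂ z) := by
  rcases A.eq_empty_or_nonempty with rfl | hA'
  · exact ⟨k₂, h₂, by simp, fun b _ => Eventually.of_forall fun _ => rfl⟩
  set u : X → E := fun z => k₁ z - k₂ z with hu_def
  have hu : UniformContinuous u := h₁.sub h₂
  set ℓ : X → ℝ := fun z => Real.log (t z) with hℓ_def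
  have hA'' : (ℓ '' A).Nonempty := hA'.image _
  set q : X → ℝ := fun z => ramp (3 / r * Metric.infDist (ℓ z) (ℓ '' A)) with hq_def
  have hqsub : ∀ z z', |q z - q z'| ≤ 3 / r * |ℓ z - ℓ z'| := by
    intro z z'
    refine (abs_ramp_sub_le _ _).trans ?_
    rw [← mul_sub, abs_mul, abs_of_pos (by positivity : 0 < 3 / r)]
    refine mul_le_mul_of_nonneg_left ?_ (by positivity)
    have := (Metric.lipschitz_infDist_pt (ℓ '' A)).dist_le_mul (ℓ z) (ℓ z')
    rwa [NNReal.coe_one, one_mul, Real.dist_eq] at this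
  have key : ∀ z z', t z ≤ t z' →
      |q z - q z'| * min ‖u z‖ ‖u z'‖ ≤ 3 / r * |t z - t z'| := by
    intro z z' hzz
    -- Where `t z = 0` the logarithm is a junk value, but there `u z = 0` and the product vanishes.
    rcases eq_or_lt_of_le ((norm_nonneg _).trans (hle z)) with h0 | h0
    · have : ‖u z‖ = 0 := le_antisymm ((hle z).trans h0.ge) (norm_nonneg _)
      rw [this, min_eq_left (norm_nonneg _), mul_zero]
      positivity
    · have a1 : |q z - q z'| * min ‖u z‖ ‖u z'‖ ≤ (3 / r * |ℓ z - ℓ z'|) * t z :=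
        mul_le_mul (hqsub z z') ((min_le_left _ _).trans (hle z))
          (le_min (norm_nonneg _) (norm_nonneg _)) (by positivity)
      refine a1.trans ?_
      rw [mul_assoc]
      refine mul_le_mul_of_nonneg_left ?_ (by positivity)
      rw [abs_sub_comm (t z), abs_of_nonneg (sub_nonneg.2 hzz)]
      exact mul_abs_log_sub_le h0 hzz
  have hsm : UniformContinuous fun z => q z • u z := by
    refine uniformContinuous_smul_of_min (fun z => abs_ramp_le _) hu ?_
    intro ε hε
    obtain ⟨δ, hδ, hd⟩ := Metric.uniformContinuous_iff.1 ht (r / 3 * ε) (by positivity)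
    refine ⟨δ, hδ, fun z z' hz => ?_⟩
    have h1 := hd hz
    rw [Real.dist_eq] at h1
    have h2 : 3 / r * |t z - t z'| < ε := by
      calc 3 / r * |t z - t z'| < 3 / r * (r / 3 * ε) := mul_lt_mul_of_pos_left h1 (by positivity)
        _ = ε := by field_simp
    rcases le_total (t z) (t z') with h | h
    · exact (key z z' h).trans_lt h2
    · have := key z' z h
      rw [abs_sub_comm (q z'), min_comm, abs_sub_comm (t z')] at this
      exact this.trans_lt h2
  have hcont : ∀ z, 0 < t z → ContinuousAt
      (fun z => 3 / r * Metric.infDist (ℓ z) (ℓ '' A)) z := fun z hz =>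
    continuousAt_const.mul ((Metric.continuous_infDist_pt (ℓ '' A)).continuousAt.comp
      (ht.continuous.continuousAt.log hz.ne'))
  refine ⟨fun z => k₂ z + q z • u z, h₂.add hsm, fun a ha => ?_, fun b hb => ?_⟩
  · have c1 : ∀ᶠ z in 𝓝 a, 3 / r * Metric.infDist (ℓ z) (ℓ '' A) < 1 := by
      refine (hcont a (hA a ha)).eventually_lt continuousAt_const ?_
      rw [Metric.infDist_zero_of_mem (Set.mem_image_of_mem _ ha)]
      simp
    filter_upwards [c1] with z hz1
    simp only [hq_def]
    rw [ramp_eq_one hz1.le]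
    simp [hu_def]
  · have c1 : ∀ᶠ z in 𝓝 b, 2 < 3 / r * Metric.infDist (ℓ z) (ℓ '' A) := by
      refine ContinuousAt.eventually_lt (f := fun _ => (2 : ℝ)) continuousAt_const
        (hcont b (hB b hb)) ?_
      have : r ≤ Metric.infDist (ℓ b) (ℓ '' A) := by
        refine (Metric.le_infDist hA'').2 ?_
        rintro _ ⟨a, ha, rfl⟩
        rw [dist_comm, Real.dist_eq]
        exact hAB a ha b hb
      calc (2 : ℝ) < 3 / r * r := by field_simp; norm_num
        _ ≤ _ := mul_le_mul_of_nonneg_left this (by positivity)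
    filter_upwards [c1] with z hz
    simp only [hq_def]
    rw [ramp_eq_zero hz.le]
    simp

theorem frequently_of_comp {P : ℕ → Prop} {σ : ℕ → ℕ} (hσ : StrictMono σ) (h : ∀ n, P (σ n)) :
    ∃ᶠ n in atTop, P n :=
  hσ.tendsto_atTop.frequently (Eventually.of_forall h).frequently

theorem strictMono_two_mul : StrictMono fun n : ℕ => 2 * n := fun _ _ h => by
  show 2 * _ < 2 * _; omega

theorem strictMono_two_mul_add_one : StrictMono fun n : ℕ => 2 * n + 1 := fun _ _ h => by
  show 2 * _ + 1 < 2 * _ + 1; omega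

/-- Along a sequence on which a majorant of the difference tends to `0` or to `∞`, two uniformly
continuous functions can be interlaced. -/
theorem exists_interlace_of_log {k₁ k₂ : X → E} (h₁ : UniformContinuous k₁)
    (h₂ : UniformContinuous k₂) {t : X → ℝ} (ht : UniformContinuous t)
    (hle : ∀ z, ‖k₁ z - k₂ z‖ ≤ t z) {x : ℕ → X} (hx : ∀ n, 0 < t (x n))
    (hlim : Tendsto (fun n => |Real.log (t (x n))|) atTop atTop) :
    ∃ g : X → E, UniformContinuous g ∧ (∃ᶠ n in atTop, ∀ᶠ z in 𝓝 (x n), g z = k₁ z) ∧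
      (∃ᶠ n in atTop, ∀ᶠ z in 𝓝 (x n), g z = k₂ z) := by
  -- The logarithms are unbounded along every subsequence, so only the separated alternative
  -- survives; even and odd terms then serve as the two sets.
  rcases exists_subseq_tendsto_or_separated (fun n => Real.log (t (x n))) with
    ⟨a, σ, hσ, hl⟩ | ⟨σ, hσ, r, hr, hsep⟩
  · exact absurd hl.abs (not_tendsto_nhds_of_tendsto_atTop (hlim.comp hσ.tendsto_atTop) _)
  · obtain ⟨g, hg, hgA, hgB⟩ := exists_glue_of_log (A := Set.range fun n => x (σ (2 * n)))
      (B := Set.range fun n => x (σ (2 * n + 1))) h₁ h₂ ht hle hr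
      (by rintro _ ⟨n, rfl⟩; exact hx _) (by rintro _ ⟨n, rfl⟩; exact hx _)
      (by
        rintro _ ⟨n, rfl⟩ _ ⟨m, rfl⟩
        exact hsep (2 * n) (2 * m + 1) (by omega))
    exact ⟨g, hg,
      frequently_of_comp (hσ.comp strictMono_two_mul) fun n => hgA _ ⟨n, rfl⟩,
      frequently_of_comp (hσ.comp strictMono_two_mul_add_one) fun n => hgB _ ⟨n, rfl⟩⟩

theorem exists_interlace_of_separated {k₁ k₂ : X → E} (h₁ : UniformContinuous k₁)
    (h₂ : UniformContinuous k₂) {x : ℕ → X} (hx : IsSeparatedSeq x) :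
    ∃ g : X → E, UniformContinuous g ∧ (∃ᶠ n in atTop, ∀ᶠ z in 𝓝 (x n), g z = k₁ z) ∧
      (∃ᶠ n in atTop, ∀ᶠ z in 𝓝 (x n), g z = k₂ z) := by
  by_cases hb : ∃ M, ∃ᶠ n in atTop, ‖k₁ (x n) - k₂ (x n)‖ ≤ M
  · obtain ⟨M, hM⟩ := hb
    obtain ⟨σ, hσ, hM⟩ := extraction_of_frequently_atTop hM
    obtain ⟨r, hr, hsep⟩ := hx.comp_strictMono hσ
    obtain ⟨g, hg, hgA, hgB⟩ := exists_glue_of_dist (A := Set.range fun n => x (σ (2 * n)))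
      (B := Set.range fun n => x (σ (2 * n + 1))) h₁ h₂ hr
      (by
        rintro _ ⟨n, rfl⟩ _ ⟨m, rfl⟩
        exact hsep (2 * n) (2 * m + 1) (by omega))
      (M := M) (by rintro _ ⟨n, rfl⟩; exact hM _)
    exact ⟨g, hg,
      frequently_of_comp (hσ.comp strictMono_two_mul) fun n => hgA _ ⟨n, rfl⟩,
      frequently_of_comp (hσ.comp strictMono_two_mul_add_one) fun n => hgB _ ⟨n, rfl⟩⟩
  · push Not at hb
    have hlim : Tendsto (fun n => ‖k₁ (x n) - k₂ (x n)‖ + 1) atTop atTop := by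
      refine tendsto_atTop.2 fun M => ?_
      filter_upwards [hb M] with n hn
      linarith
    -- The `+ 1` keeps the majorant positive at every `x n`.
    refine exists_interlace_of_log h₁ h₂ (t := fun z => ‖k₁ z - k₂ z‖ + 1)
      ((uniformContinuous_norm.comp (h₁.sub h₂)).add uniformContinuous_const)
      (fun z => by linarith) (fun n => by positivity) ?_
    exact tendsto_abs_atTop_atTop.comp (Real.tendsto_log_atTop.comp hlim)

end Glue

/-! ### Correspondence of open sets under a biseparating map. -/

section Bisep

/-- Pointwise form of the biseparating condition. -/
def PreservesSeparation {X Y E F : Type*} {A : Set (X → E)} {B : Set (Y → F)} (T : A ≃ B) :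
    Prop :=
  ∀ f g h : A, (∀ x, f.1 x = h.1 x ∨ g.1 x = h.1 x) ↔
    ∀ y, (T f).1 y = (T h).1 y ∨ (T g).1 y = (T h).1 y

theorem PreservesSeparation.symm {X Y E F : Type*} {A : Set (X → E)} {B : Set (Y → F)}
    {T : A ≃ B} (hT : PreservesSeparation T) : PreservesSeparation T.symm := by
  intro f g h
  simpa using (hT (T.symm f) (T.symm g) (T.symm h)).symm

theorem disjointWrt_iff_forall {X E : Type*} [AddGroup E] (f g h : X → E) :
    DisjointWrt f g h ↔ ∀ x, f x = h x ∨ g x = h x := by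
  simp only [DisjointWrt, Set.disjoint_left, Function.mem_support, Pi.sub_apply, sub_ne_zero,
    not_not, or_iff_not_imp_left]

variable {X Y E F : Type*} [MetricSpace X] [MetricSpace Y]
  [NormedAddCommGroup E] [NormedAddCommGroup F]

theorem UC.continuous (f : UC X E) : Continuous f.1 := UniformContinuous.continuous f.2

theorem isOpen_ne_UC (f g : UC X E) : IsOpen {x | f.1 x ≠ g.1 x} :=
  isOpen_ne_fun (UC.continuous f) (UC.continuous g)

/-- The largest open set on which the values of `T f` are determined by those of `f` on `V`. -/
def transport (T : UC X E → UC Y F) (V : Set X) : Set Y :=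
  {y | ∃ W, IsOpen W ∧ y ∈ W ∧ ∀ f g : UC X E, Set.EqOn f.1 g.1 V → Set.EqOn (T f).1 (T g).1 W}

theorem transport_mono (T : UC X E → UC Y F) {V V' : Set X} (h : V ⊆ V') :
    transport T V ⊆ transport T V' := by
  rintro y ⟨W, hW, hy, H⟩
  exact ⟨W, hW, hy, fun f g hfg => H f g (hfg.mono h)⟩

theorem isOpen_transport (T : UC X E → UC Y F) (V : Set X) : IsOpen (transport T V) := by
  refine isOpen_iff_forall_mem_open.2 ?_
  rintro y ⟨W, hW, hy, H⟩
  exact ⟨W, fun z hz => ⟨W, hW, hz, H⟩, hW, hy⟩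

theorem eqOn_transport {T : UC X E → UC Y F} {V : Set X} {f g : UC X E}
    (h : Set.EqOn f.1 g.1 V) : Set.EqOn (T f).1 (T g).1 (transport T V) := by
  rintro y ⟨W, -, hy, H⟩
  exact H f g h hy

variable [NormedSpace ℝ E]

theorem exists_uniformContinuous_ne_zero_iff {V : Set X} (hV : IsOpen V) :
    ∃ χ : X → ℝ, UniformContinuous χ ∧ ∀ x, χ x ≠ 0 ↔ x ∈ V := by
  rcases Vᶜ.eq_empty_or_nonempty with h | h
  · refine ⟨fun _ => 1, uniformContinuous_const, fun x => ?_⟩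
    rw [Set.compl_empty_iff] at h
    simp [h]
  · refine ⟨fun x => Metric.infDist x Vᶜ, Metric.uniformContinuous_infDist_pt _, fun x => ?_⟩
    rw [← Set.notMem_compl_iff (s := V)]
    exact not_congr (hV.isClosed_compl.mem_iff_infDist_zero h).symm

theorem exists_UC_ne_iff [Nontrivial E] {V : Set X} (hV : IsOpen V) (h : UC X E) :
    ∃ f : UC X E, ∀ x, f.1 x ≠ h.1 x ↔ x ∈ V := by
  obtain ⟨χ, hχ, hχV⟩ := exists_uniformContinuous_ne_zero_iff hV
  obtain ⟨e, he⟩ := exists_ne (0 : E)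
  refine ⟨⟨fun x => h.1 x + χ x • e, UniformContinuous.add h.2
    (((ContinuousLinearMap.id ℝ ℝ).smulRight e).uniformContinuous.comp hχ)⟩, fun x => ?_⟩
  rw [← hχV]
  simp [he]

/-- A function vanishing on `V` but not at a point `x` outside `closure V` cannot be determined near
`x` by its values on `V`; this uses only that `T` is a bijection. -/
theorem transport_transport_subset [Nontrivial E] (T : UC X E ≃ UC Y F) (V : Set X) :
    transport T.symm (transport T V) ⊆ closure V := by
  intro x hx
  by_contra hxV
  obtain ⟨d, hd⟩ := exists_UC_ne_iff
    ((isOpen_transport T.symm (transport T V)).sdiff (isClosed_closure (s := V)))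
    (⟨fun _ => 0, uniformContinuous_const⟩ : UC X E)
  have h1 : Set.EqOn d.1 (⟨fun _ => 0, uniformContinuous_const⟩ : UC X E).1 V := by
    intro z hz
    by_contra hc
    exact ((hd z).1 hc).2 (subset_closure hz)
  have h2 := eqOn_transport (T := T.symm) (eqOn_transport (T := T) h1)
  rw [T.symm_apply_apply, T.symm_apply_apply] at h2
  exact (hd x).2 ⟨hx, hxV⟩ (h2 hx)

variable [NormedSpace ℝ F] [Nontrivial E] [Nontrivial F] {T : UC X E ≃ UC Y F}

/-- Otherwise some open `W` corresponds, relative to `f`, to `{b ≠ f}` inside `closure V` and,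
relative to `h`, to `{a ≠ h}` off `V`; these sets are disjoint. A function equal to `f` on a small
ball in `{b ≠ f}` and to `h` off a larger one forces `T f = T h` on a nonempty open part of `W`. A
modification `f₁` of `f` inside the small ball must then satisfy `T f₁ = T h` there too, although
that part was chosen with `T f₁ ≠ T f`. -/
theorem PreservesSeparation.ne_subset_closure (hT : PreservesSeparation T) {V : Set X}
    {f h fV hV' : UC X E} (hf : ∀ x, fV.1 x ≠ f.1 x ↔ x ∈ V)
    (hh : ∀ x, hV'.1 x ≠ h.1 x ↔ x ∈ V) :
    {y | (T fV).1 y ≠ (T f).1 y} ⊆ closure {y | (T hV').1 y ≠ (T h).1 y} := by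
  intro y hy
  by_contra hyc
  set W : Set Y := {y | (T fV).1 y ≠ (T f).1 y} \ closure {y | (T hV').1 y ≠ (T h).1 y} with hW
  have hWo : IsOpen W := (isOpen_ne_UC _ _).sdiff isClosed_closure
  have hyW : y ∈ W := ⟨hy, hyc⟩
  obtain ⟨a', ha'⟩ := exists_UC_ne_iff hWo (T h)
  obtain ⟨a, rfl⟩ := T.surjective a'
  obtain ⟨b', hb'⟩ := exists_UC_ne_iff hWo (T f)
  obtain ⟨b, rfl⟩ := T.surjective b'
  -- the part of `X` corresponding to `W` relative to `h` misses `V`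
  have hVa : ∀ x ∈ V, a.1 x = h.1 x := by
    intro x hx
    refine (((hT a hV' h).2 fun z => ?_) x).resolve_right ((hh x).2 hx)
    by_contra! hc
    exact ((ha' z).1 hc.1).2 (subset_closure hc.2)
  -- the part of `X` corresponding to `W` relative to `f` lies in the closure of `V`
  have hVb : ∀ x, b.1 x ≠ f.1 x → x ∈ closure V := by
    intro x hx
    by_contra hxV
    obtain ⟨d, hd⟩ := exists_UC_ne_iff ((isOpen_ne_UC b f).sdiff (isClosed_closure (s := V))) f
    have h1 := (hT d fV f).1 fun z => by
      by_contra! hc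
      exact ((hd z).1 hc.1).2 (subset_closure ((hf z).1 hc.2))
    have h2 := (hT d b f).2 fun z => by
      by_contra! hc
      exact (h1 z).elim hc.1 ((hb' z).1 hc.2).1
    exact (h2 x).elim ((hd x).2 ⟨hx, hxV⟩) hx
  have hdisj : ∀ x, b.1 x ≠ f.1 x → a.1 x = h.1 x := by
    intro x hx
    by_contra hc
    obtain ⟨z, hz1, hz2⟩ := mem_closure_iff.1 (hVb x hx) _ (isOpen_ne_UC a h) hc
    exact hz1 (hVa z hz2)
  obtain ⟨x, hx⟩ : ∃ x, b.1 x ≠ f.1 x := by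
    by_contra! hc
    have : b = f := Subtype.ext (funext hc)
    exact (hb' y).2 hyW (by rw [this])
  obtain ⟨ρ, hρ, hball⟩ := Metric.isOpen_iff.1 (isOpen_ne_UC b f) x hx
  have hev : ∀ᶠ z in 𝓝 x, ‖f.1 z - h.1 z‖ < ‖f.1 x - h.1 x‖ + 1 :=
    ((UC.continuous f).sub (UC.continuous h)).norm.continuousAt.eventually_lt continuousAt_const
      (by simp)
  obtain ⟨ρ', hρ', hbound⟩ := Metric.eventually_nhds_iff.1 hev
  set s := min (ρ / 2) ρ' with hs
  have hs0 : 0 < s := by positivity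
  obtain ⟨f₁, hf₁⟩ := exists_UC_ne_iff (Metric.isOpen_ball (x := x) (ε := s)) f
  have hballb : ∀ z ∈ Metric.ball x s, b.1 z ≠ f.1 z := fun z hz =>
    hball (Metric.ball_subset_ball ((min_le_left _ _).trans (by linarith)) hz)
  obtain ⟨y₁, hy₁⟩ : ∃ y₁, y₁ ∈ W ∩ {y | (T f₁).1 y ≠ (T f).1 y} := by
    by_contra! hc
    have h1 := (hT f₁ b f).2 fun z => by
      by_contra! hc'
      exact hc z ⟨(hb' z).1 hc'.2, hc'.1⟩
    exact (h1 x).elim ((hf₁ x).2 (Metric.mem_ball_self hs0)) hx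
  obtain ⟨a₁', ha₁⟩ := exists_UC_ne_iff (hWo.inter (isOpen_ne_UC (T f₁) (T f))) (T h)
  obtain ⟨a₁, rfl⟩ := T.surjective a₁'
  have hdisj₁ : ∀ z, b.1 z ≠ f.1 z → a₁.1 z = h.1 z := by
    intro x hx
    by_contra hc
    obtain ⟨d, hd⟩ := exists_UC_ne_iff ((isOpen_ne_UC b f).inter (isOpen_ne_UC a₁ h)) h
    have h1 := (hT d a h).1 fun z => by
      by_contra! hc
      exact hc.2 (hdisj z ((hd z).1 hc.1).1)
    have h2 := (hT d a₁ h).2 fun z => by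
      by_contra! hc
      exact (h1 z).elim hc.1 ((ha' z).2 ((ha₁ z).1 hc.2).1)
    exact (h2 x).elim ((hd x).2 ⟨hx, hc⟩) hc
  -- Here `g` does not meet `f₁` relative to `f`, nor `a₁` relative to `h`, so `T g` equals both `T
  -- f` and `T h` on the chosen part of `W`.
  obtain ⟨g, hg, hgA, hgB⟩ := exists_glue_of_dist f.2 h.2 (A := Metric.ball x s)
    (B := (Metric.ball x ρ)ᶜ) (r := ρ / 2) (by positivity)
    (by
      intro p hp q hq
      rw [Metric.mem_ball] at hp
      rw [Set.mem_compl_iff, Metric.mem_ball, not_lt] at hq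
      have := dist_triangle q p x
      rw [dist_comm q p] at this
      linarith [min_le_left (ρ / 2) ρ'])
    (M := ‖f.1 x - h.1 x‖ + 1)
    (fun p hp => (hbound (lt_of_lt_of_le (Metric.mem_ball.1 hp) (min_le_right _ _))).le)
  have hgf := (hT ⟨g, hg⟩ f₁ f).1 fun z => by
    by_contra! hc
    exact hc.1 (hgA z ((hf₁ z).1 hc.2)).self_of_nhds
  have hgh := (hT ⟨g, hg⟩ a₁ h).1 fun z => by
    by_contra! hc
    by_cases hz : z ∈ Metric.ball x ρ
    · exact hc.2 (hdisj₁ z (hball hz))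
    · exact hc.1 (hgB z hz).self_of_nhds
  have hfh : ∀ z ∈ W ∩ {y | (T f₁).1 y ≠ (T f).1 y}, (T f).1 z = (T h).1 z := fun z hz =>
    ((hgf z).resolve_right hz.2).symm.trans ((hgh z).resolve_right ((ha₁ z).2 hz))
  have h3 := (hT f a₁ h).2 fun z => by
    by_contra! hc
    exact hc.1 (hfh z ((ha₁ z).1 hc.2))
  have h4 := (hT f₁ a₁ h).1 fun z => by
    by_cases hz : b.1 z ≠ f.1 z
    · exact Or.inr (hdisj₁ z hz)
    · refine (h3 z).imp_left fun h5 => ?_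
      have : f₁.1 z = f.1 z := by
        by_contra hc
        exact hz (hballb z ((hf₁ z).1 hc))
      rw [this, h5]
  exact hy₁.2 (((h4 y₁).resolve_right ((ha₁ y₁).2 hy₁)).trans (hfh y₁ hy₁).symm)

/-- Perturbing `g` exactly on `V` changes `T g` only inside `transport T V`, by independence of the
base function; separation then brings equality back to `V`. -/
theorem PreservesSeparation.eqOn_of_eqOn_transport (hT : PreservesSeparation T) {V : Set X}
    (hV : IsOpen V) {f g : UC X E} (h : Set.EqOn (T f).1 (T g).1 (transport T V)) :
    Set.EqOn f.1 g.1 V := by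
  obtain ⟨gV, hgV⟩ := exists_UC_ne_iff hV g
  have hsub : {y | (T gV).1 y ≠ (T g).1 y} ⊆ transport T V := by
    intro y hy
    refine ⟨_, isOpen_ne_UC (T gV) (T g), hy, fun f₁ f₂ h12 => ?_⟩
    obtain ⟨k, hk⟩ := exists_UC_ne_iff hV f₂
    have h1 := (hT f₁ k f₂).1 fun x => by
      by_contra! hc
      exact hc.1 (h12 ((hk x).1 hc.2))
    have h2 : Set.EqOn (T f₁).1 (T f₂).1 (closure {y | (T k).1 y ≠ (T f₂).1 y}) :=
      Set.EqOn.closure (fun z hz => (h1 z).resolve_right hz) 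
      (UC.continuous (T f₁)) (UC.continuous (T f₂))
    exact h2.mono (hT.ne_subset_closure hgV hk)
  have h1 := (hT f gV g).2 fun y => by
    by_contra! hc
    exact hc.1 (h (hsub hc.2))
  exact fun x hx => (h1 x).resolve_right ((hgV x).2 hx)

theorem PreservesSeparation.subset_transport_transport (hT : PreservesSeparation T) {V : Set X}
    (hV : IsOpen V) : V ⊆ transport T.symm (transport T V) := by
  intro x hx
  refine ⟨V, hV, hx, fun f g hfg => ?_⟩
  exact hT.eqOn_of_eqOn_transport hV (by simpa using hfg)

theorem PreservesSeparation.transport_nonempty (hT : PreservesSeparation T) {V : Set X}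
    (hV : IsOpen V) (hne : V.Nonempty) : (transport T V).Nonempty := by
  by_contra hc
  rw [Set.not_nonempty_iff_eq_empty] at hc
  obtain ⟨x, hx⟩ := hne
  obtain ⟨d, hd⟩ := exists_UC_ne_iff hV (⟨fun _ => 0, uniformContinuous_const⟩ : UC X E)
  exact (hd x).2 hx (hT.eqOn_of_eqOn_transport hV (by rw [hc]; exact Set.eqOn_empty _ _) hx)

end Bisep

/-! ### The induced homeomorphism and pointwise action. -/

section PointMap

variable {X Y E F : Type*} [MetricSpace X] [MetricSpace Y]
  [NormedAddCommGroup E] [NormedAddCommGroup F]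

/-- The constant function with value `e`. -/
def UC.const (X : Type*) {E : Type*} [UniformSpace X] [UniformSpace E] (e : E) : UC X E :=
  ⟨fun _ => e, uniformContinuous_const⟩

variable [NormedSpace ℝ E] [NormedSpace ℝ F] [Nontrivial E] [Nontrivial F] {T : UC X E ≃ UC Y F}

/-- Local agreement with `T f` pulls back to agreement with `f` at points arbitrarily close to `x`,
and continuity gives the value at `x`. -/
theorem PreservesSeparation.symm_apply_eq_of_transport (hT : PreservesSeparation T) {x : X}
    {k : UC Y F} {f : UC X E}
    (h : ∀ r > 0, ∃ y ∈ transport T (Metric.ball x r), ∀ᶠ z in 𝓝 y, k.1 z = (T f).1 z) :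
    (T.symm k).1 x = f.1 x := by
  have hcl : x ∈ closure {z | (T.symm k).1 z = f.1 z} := by
    refine Metric.mem_closure_iff.2 fun ε hε => ?_
    obtain ⟨y, hy, hev⟩ := h (ε / 2) (by positivity)
    obtain ⟨P, hP, hPo, hyP⟩ := eventually_nhds_iff.1
      (hev.and ((isOpen_transport T _).mem_nhds hy))
    obtain ⟨z, hz⟩ := hT.symm.transport_nonempty hPo ⟨y, hyP⟩
    have h1 : Set.EqOn (T.symm k).1 (T.symm (T f)).1 (transport T.symm P) :=
      eqOn_transport fun w hw => (hP w hw).1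
    have h2 := transport_transport_subset T _
      (transport_mono T.symm (fun w hw => (hP w hw).2 : P ⊆ transport T _) hz)
    refine ⟨z, by simpa using h1 hz, ?_⟩
    have := Metric.closure_ball_subset_closedBall h2
    rw [Metric.mem_closedBall, dist_comm] at this
    linarith
  rwa [(isClosed_eq (UC.continuous _) (UC.continuous _)).closure_eq] at hcl

/-- If the transports did not shrink to a point, the images of two distinct constants could be glued
into one function agreeing with each of them in transports of arbitrarily small balls, so its
preimage would have two values at `x`. -/
theorem PreservesSeparation.exists_point [CompleteSpace Y] (hT : PreservesSeparation T) (x : X) :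
    ∃ y : Y, ∀ ε > 0, ∃ r > 0, transport T (Metric.ball x r) ⊆ Metric.ball y ε := by
  obtain ⟨e, he⟩ := exists_ne (0 : E)
  have hfalse : ∀ g : Y → F, UniformContinuous g →
      (∀ r > 0, ∃ y ∈ transport T (Metric.ball x r), ∀ᶠ z in 𝓝 y, g z = (T (UC.const X e)).1 z) →
      (∀ r > 0, ∃ y ∈ transport T (Metric.ball x r), ∀ᶠ z in 𝓝 y, g z = (T (UC.const X 0)).1 z) →
      False := by
    intro g hg h1 h2
    have a1 := hT.symm_apply_eq_of_transport (k := ⟨g, hg⟩) h1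
    have a2 := hT.symm_apply_eq_of_transport (k := ⟨g, hg⟩) h2
    exact he (a1.symm.trans a2)
  have hne : ∀ n : ℕ, (transport T (Metric.ball x (1 / ((n : ℝ) + 1)))).Nonempty := fun n =>
    hT.transport_nonempty Metric.isOpen_ball ⟨x, Metric.mem_ball_self (by positivity)⟩
  choose y hy using hne
  have hsmall : ∀ σ : ℕ → ℕ, StrictMono σ → ∀ r > 0, ∀ᶠ n in atTop,
      y (σ n) ∈ transport T (Metric.ball x r) := by
    intro σ hσ r hr
    filter_upwards [(tendsto_one_div_add_atTop_nhds_zero_nat.comp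
      hσ.tendsto_atTop).eventually_lt_const hr] with n hn
    exact transport_mono T (Metric.ball_subset_ball hn.le) (hy (σ n))
  rcases exists_subseq_tendsto_or_separated y with ⟨a, σ, hσ, hlim⟩ | ⟨σ, hσ, hsep⟩
  · refine ⟨a, fun ε hε => ?_⟩
    by_contra! hc
    have hev : ∀ᶠ z in 𝓝 a, ‖(T (UC.const X e)).1 z - (T (UC.const X 0)).1 z‖ <
        ‖(T (UC.const X e)).1 a - (T (UC.const X 0)).1 a‖ + 1 :=
      ((UC.continuous _).sub (UC.continuous _)).norm.continuousAt.eventually_lt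
        continuousAt_const (by simp)
    obtain ⟨ρ, hρ, hbound⟩ := Metric.eventually_nhds_iff.1 hev
    obtain ⟨g, hg, hgA, hgB⟩ := exists_glue_of_dist (T (UC.const X e)).2 (T (UC.const X 0)).2
      (A := Metric.ball a (min (ε / 2) ρ)) (B := (Metric.ball a ε)ᶜ) (r := ε / 2) (by positivity)
      (by
        intro p hp q hq
        rw [Metric.mem_ball] at hp
        rw [Set.mem_compl_iff, Metric.mem_ball, not_lt] at hq
        have := dist_triangle q p a
        rw [dist_comm q p] at this
        linarith [min_le_left (ε / 2) ρ])
      (fun p hp => (hbound (lt_of_lt_of_le (Metric.mem_ball.1 hp) (min_le_right _ _))).le)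
    refine hfalse g hg (fun r hr => ?_) fun r hr => ?_
    · obtain ⟨n, hn1, hn2⟩ := ((hsmall σ hσ r hr).and
        (hlim.eventually (Metric.ball_mem_nhds a (ε := min (ε / 2) ρ) (by positivity)))).exists
      exact ⟨_, hn1, hgA _ hn2⟩
    · obtain ⟨z, hz, hza⟩ := Set.not_subset.1 (hc r hr)
      exact ⟨z, hz, hgB z hza⟩
  · exfalso
    obtain ⟨g, hg, hgA, hgB⟩ := exists_interlace_of_separated (T (UC.const X e)).2
      (T (UC.const X 0)).2 hsep
    refine hfalse g hg (fun r hr => ?_) fun r hr => ?_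
    · obtain ⟨n, hn1, hn2⟩ := (hgA.and_eventually (hsmall σ hσ r hr)).exists
      exact ⟨_, hn2, hn1⟩
    · obtain ⟨n, hn1, hn2⟩ := (hgB.and_eventually (hsmall σ hσ r hr)).exists
      exact ⟨_, hn2, hn1⟩

theorem PreservesSeparation.continuous_of_transport (hT : PreservesSeparation T) {φ : X → Y}
    (hφ : ∀ x, ∀ ε > 0, ∃ r > 0, transport T (Metric.ball x r) ⊆ Metric.ball (φ x) ε) :
    Continuous φ := by
  refine Metric.continuous_iff.2 fun x ε hε => ?_
  obtain ⟨r, hr, hsub⟩ := hφ x (ε / 2) (by positivity)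
  refine ⟨r, hr, fun x₁ hx₁ => ?_⟩
  obtain ⟨r₁, hr₁, hsub₁⟩ := hφ x₁ (ε / 2) (by positivity)
  obtain ⟨y, hy⟩ := hT.transport_nonempty (V := Metric.ball x r ∩ Metric.ball x₁ r₁)
    (Metric.isOpen_ball.inter Metric.isOpen_ball) ⟨x₁, hx₁, Metric.mem_ball_self hr₁⟩
  have h1 := hsub (transport_mono T Set.inter_subset_left hy)
  have h2 := hsub₁ (transport_mono T Set.inter_subset_right hy)
  rw [Metric.mem_ball] at h1 h2
  have := dist_triangle_left (φ x₁) (φ x) y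
  linarith

theorem PreservesSeparation.leftInverse_of_transport (hT : PreservesSeparation T) {φ : X → Y}
    {ψ : Y → X} (hφ : ∀ x, ∀ ε > 0, ∃ r > 0, transport T (Metric.ball x r) ⊆ Metric.ball (φ x) ε)
    (hψ : ∀ y, ∀ ε > 0, ∃ r > 0, transport T.symm (Metric.ball y r) ⊆ Metric.ball (ψ y) ε)
    (x : X) : ψ (φ x) = x := by
  refine eq_of_forall_dist_le fun ε hε => ?_
  obtain ⟨s, hs, hsub⟩ := hψ (φ x) ε hε
  obtain ⟨r, hr, hsub'⟩ := hφ x s hs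
  have := hsub (transport_mono T.symm hsub'
    (hT.subset_transport_transport Metric.isOpen_ball (Metric.mem_ball_self hr)))
  rw [dist_comm]
  exact (Metric.mem_ball.1 this).le

theorem PreservesSeparation.apply_eq_of_eventuallyEq (hT : PreservesSeparation T) {φ : X → Y}
    (hφ : ∀ x, ∀ ε > 0, ∃ r > 0, transport T (Metric.ball x r) ⊆ Metric.ball (φ x) ε)
    {x : X} {k f : UC X E}
    (h : ∀ r > 0, ∃ z ∈ Metric.ball x r, ∀ᶠ w in 𝓝 z, k.1 w = f.1 w) :
    (T k).1 (φ x) = (T f).1 (φ x) := by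
  have hcl : φ x ∈ closure {z | (T k).1 z = (T f).1 z} := by
    refine Metric.mem_closure_iff.2 fun ε hε => ?_
    obtain ⟨r, hr, hsub⟩ := hφ x ε hε
    obtain ⟨z, hz, hev⟩ := h r hr
    obtain ⟨P, hP, hPo, hzP⟩ := eventually_nhds_iff.1
      (hev.and (Metric.isOpen_ball.mem_nhds hz))
    obtain ⟨w, hw⟩ := hT.transport_nonempty hPo ⟨z, hzP⟩
    refine ⟨w, eqOn_transport (fun w hw => (hP w hw).1) hw, ?_⟩
    rw [dist_comm]
    exact hsub (transport_mono T (fun w hw => (hP w hw).2) hw)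
  rwa [(isClosed_eq (UC.continuous _) (UC.continuous _)).closure_eq] at hcl

/-- At an accumulation point, a function interlacing `f` and `h` along a sequence tending to `x` has
an image whose value at `φ x` is that of both `T f` and `T h`. -/
theorem PreservesSeparation.apply_eq_of_apply_eq (hT : PreservesSeparation T) {φ : X → Y}
    (hφ : ∀ x, ∀ ε > 0, ∃ r > 0, transport T (Metric.ball x r) ⊆ Metric.ball (φ x) ε)
    {x : X} {f h : UC X E} (hfh : f.1 x = h.1 x) : (T f).1 (φ x) = (T h).1 (φ x) := by
  by_cases hx : 𝓝[≠] x = ⊥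
  · refine hT.apply_eq_of_eventuallyEq hφ fun r hr => ⟨x, Metric.mem_ball_self hr, ?_⟩
    rw [← isOpen_singleton_iff_punctured_nhds] at hx
    filter_upwards [hx.mem_nhds rfl] with w hw
    rw [Set.mem_singleton_iff.1 hw, hfh]
  · have : (𝓝[≠] x).NeBot := ⟨hx⟩
    obtain ⟨u, hu⟩ := exists_seq_tendsto (𝓝[≠] x)
    rw [tendsto_nhdsWithin_iff] at hu
    obtain ⟨N, hN⟩ := eventually_atTop.1 hu.2
    have hlim : Tendsto (fun n => u (n + N)) atTop (𝓝 x) := hu.1.comp (tendsto_add_atTop_nat N)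
    -- Adding the distance keeps `t` positive off `x` even where `f = h`, while `t` still tends to
    -- `0` at `x`.
    set t : X → ℝ := fun z => ‖f.1 z - h.1 z‖ + dist z x with ht
    have htu : UniformContinuous t :=
      (uniformContinuous_norm.comp (UniformContinuous.sub f.2 h.2)).add
        (uniformContinuous_id.dist uniformContinuous_const)
    have htpos : ∀ n, 0 < t (u (n + N)) := fun n =>
      add_pos_of_nonneg_of_pos (norm_nonneg _) (dist_pos.2 (hN _ (Nat.le_add_left _ _)))
    have htlim : Tendsto (fun n => t (u (n + N))) atTop (𝓝[>] 0) := by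
      refine tendsto_nhdsWithin_iff.2 ⟨?_, Eventually.of_forall htpos⟩
      have := (htu.continuous.tendsto x).comp hlim
      rwa [show t x = 0 by simp [ht, hfh]] at this
    obtain ⟨g, hg, hgf, hgh⟩ := exists_interlace_of_log f.2 h.2 htu
      (fun z => le_add_of_nonneg_right dist_nonneg) htpos
      (tendsto_abs_atBot_atTop.comp (Real.tendsto_log_nhdsGT_zero.comp htlim))
    have h1 : (T ⟨g, hg⟩).1 (φ x) = (T f).1 (φ x) := hT.apply_eq_of_eventuallyEq hφ fun r hr => by
      obtain ⟨n, hn1, hn2⟩ := (hgf.and_eventually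
        (hlim.eventually (Metric.ball_mem_nhds x hr))).exists
      exact ⟨_, hn2, hn1⟩
    have h2 : (T ⟨g, hg⟩).1 (φ x) = (T h).1 (φ x) := hT.apply_eq_of_eventuallyEq hφ fun r hr => by
      obtain ⟨n, hn1, hn2⟩ := (hgh.and_eventually
        (hlim.eventually (Metric.ball_mem_nhds x hr))).exists
      exact ⟨_, hn2, hn1⟩
    exact h1.symm.trans h2

/-- `T` acts pointwise along a homeomorphism of the underlying complete metric spaces. -/
theorem PreservesSeparation.exists_homeomorph [CompleteSpace X] [CompleteSpace Y]
    (hT : PreservesSeparation T) :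
    ∃ φ : X ≃ₜ Y, ∀ (f h : UC X E) (x : X), f.1 x = h.1 x ↔ (T f).1 (φ x) = (T h).1 (φ x) := by
  choose φ hφ using hT.exists_point
  choose ψ hψ using hT.symm.exists_point
  have hl := hT.leftInverse_of_transport hφ hψ
  have hr : ∀ y, φ (ψ y) = y := hT.symm.leftInverse_of_transport hψ hφ
  refine ⟨⟨⟨φ, ψ, hl, hr⟩, hT.continuous_of_transport hφ, hT.symm.continuous_of_transport hψ⟩,
    fun f h x => ⟨hT.apply_eq_of_apply_eq hφ, fun hx => ?_⟩⟩
  have := hT.symm.apply_eq_of_apply_eq hψ (f := T f) (h := T h) hx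
  simpa [hl] using this

end PointMap

/-! ### Sums of bumps with disjoint supports. -/

section Bumps

variable {X E : Type*} [PseudoMetricSpace X] [NormedAddCommGroup E]

/-- A uniformly equicontinuous family with pairwise disjoint supports has a uniformly continuous
sum. -/
theorem exists_sum_of_disjoint {ι : Type*} {p : ι → X → E}
    (hdis : ∀ i j z, p i z ≠ 0 → p j z ≠ 0 → i = j)
    (heq : ∀ ε > 0, ∃ δ > 0, ∀ i z z', dist z z' < δ → ‖p i z - p i z'‖ < ε) :
    ∃ P : X → E, UniformContinuous P ∧ (∀ i z, p i z ≠ 0 → P z = p i z) ∧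
      ∀ z, (∀ i, p i z = 0) → P z = 0 := by
  classical
  set P : X → E := fun z => if h : ∃ i, p i z ≠ 0 then p h.choose z else 0 with hP
  have h1 : ∀ i z, p i z ≠ 0 → P z = p i z := by
    intro i z hi
    have hex : ∃ i, p i z ≠ 0 := ⟨i, hi⟩
    simp only [hP]
    rw [dif_pos hex, hdis _ _ z hex.choose_spec hi]
  have h2 : ∀ z, (∀ i, p i z = 0) → P z = 0 := by
    intro z hz
    simp only [hP]
    rw [dif_neg (by push Not; exact hz)]
  refine ⟨P, Metric.uniformContinuous_iff.2 fun ε hε => ?_, h1, h2⟩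
  obtain ⟨δ, hδ, hd⟩ := heq (ε / 2) (by positivity)
  refine ⟨δ, hδ, fun {z z'} hz => ?_⟩
  have hz' : dist z' z < δ := by rwa [dist_comm]
  rw [dist_eq_norm]
  by_cases hA : ∃ i, p i z ≠ 0
  · obtain ⟨i, hi⟩ := hA
    by_cases hB : ∃ j, p j z' ≠ 0
    · obtain ⟨j, hj⟩ := hB
      rw [h1 i z hi, h1 j z' hj]
      by_cases hij : i = j
      · subst hij
        linarith [hd i z z' hz]
      · have a1 : p i z' = 0 := by
          by_contra hc
          exact hij (hdis i j z' hc hj)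
        have a2 : p j z = 0 := by
          by_contra hc
          exact hij (hdis i j z hi hc)
        have b1 := hd i z z' hz
        have b2 := hd j z' z hz'
        rw [a1, sub_zero] at b1
        rw [a2, sub_zero] at b2
        linarith [norm_sub_le (p i z) (p j z')]
    · push Not at hB
      rw [h1 i z hi, h2 z' hB, ← hB i]
      linarith [hd i z z' hz]
  · push Not at hA
    by_cases hB : ∃ j, p j z' ≠ 0
    · obtain ⟨j, hj⟩ := hB
      rw [h1 j z' hj, h2 z hA, ← hA j]
      linarith [hd j z z' hz]
    · push Not at hB
      rw [h2 z hA, h2 z' hB]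
      simpa using hε

variable [NormedSpace ℝ E]

/-- Bumps of heights tending to zero over disjoint balls of arbitrary radii. -/
theorem exists_bumps {x : ℕ → X} {ρ : ℕ → ℝ} (hρ : ∀ n, 0 < ρ n)
    (hdis : ∀ m n, m ≠ n → ρ m + ρ n ≤ dist (x m) (x n)) {Δ : ℕ → E}
    (hΔ : Tendsto Δ atTop (𝓝 0)) :
    ∃ p : X → E, UniformContinuous p ∧ (∀ n, p (x n) = Δ n) ∧
      ∀ z, (∀ n, ρ n ≤ dist z (x n)) → p z = 0 := by
  set p : ℕ → X → E := fun n z => ramp (1 + dist z (x n) / ρ n) • Δ n with hp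
  have hzero : ∀ n z, ρ n ≤ dist z (x n) → p n z = 0 := by
    intro n z h
    simp only [hp]
    rw [ramp_eq_zero, zero_smul]
    linarith [(one_le_div (hρ n)).2 h]
  have hself : ∀ n, p n (x n) = Δ n := by
    intro n
    simp only [hp]
    rw [ramp_eq_one (by simp), one_smul]
  have hsub : ∀ n z z', ‖p n z - p n z'‖ ≤ dist z z' * (‖Δ n‖ / ρ n) := by
    intro n z z'
    simp only [hp]
    rw [← sub_smul, norm_smul, Real.norm_eq_abs]
    have h1 := abs_ramp_sub_le (1 + dist z (x n) / ρ n) (1 + dist z' (x n) / ρ n)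
    rw [add_sub_add_left_eq_sub, ← sub_div, abs_div, abs_of_pos (hρ n)] at h1
    calc _ ≤ dist z z' / ρ n * ‖Δ n‖ := by
          refine mul_le_mul_of_nonneg_right (h1.trans ?_) (norm_nonneg _)
          exact div_le_div_of_nonneg_right (abs_dist_sub_le _ _ _) (hρ n).le
      _ = _ := by ring
  have hsub' : ∀ n z z', ‖p n z - p n z'‖ ≤ ‖Δ n‖ := by
    intro n z z'
    simp only [hp]
    rw [← sub_smul, norm_smul, Real.norm_eq_abs]
    refine mul_le_of_le_one_left (norm_nonneg _) (abs_le.2 ⟨?_, ?_⟩)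
    · linarith [ramp_nonneg (1 + dist z (x n) / ρ n), ramp_le_one (1 + dist z' (x n) / ρ n)]
    · linarith [ramp_nonneg (1 + dist z' (x n) / ρ n), ramp_le_one (1 + dist z (x n) / ρ n)]
  have hlt : ∀ n z, p n z ≠ 0 → dist z (x n) < ρ n := fun n z h => by
    by_contra hc
    exact h (hzero n z (not_lt.1 hc))
  obtain ⟨P, hP, h1, h2⟩ := exists_sum_of_disjoint (p := p)
    (by
      intro m n z hm hn
      by_contra hmn
      have := hdis m n hmn
      linarith [dist_triangle_left (x m) (x n) z, hlt m z hm, hlt n z hn])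
    (by
      intro ε hε
      -- From `N` on the heights are below `ε`, however steep the bumps; the finitely many earlier
      -- ones share the Lipschitz constant `C`.
      obtain ⟨N, hN⟩ := eventually_atTop.1 ((tendsto_zero_iff_norm_tendsto_zero.1
        hΔ).eventually_lt_const hε)
      set C := ∑ n ∈ Finset.range N, ‖Δ n‖ / ρ n with hC
      have hterm : ∀ n, 0 ≤ ‖Δ n‖ / ρ n := fun n => div_nonneg (norm_nonneg _) (hρ n).le
      have hC0 : 0 ≤ C := Finset.sum_nonneg fun n _ => hterm n
      refine ⟨ε / (C + 1), by positivity, fun n z z' hz => ?_⟩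
      rcases lt_or_ge n N with hn | hn
      · have hle : ‖Δ n‖ / ρ n ≤ C :=
          Finset.single_le_sum (f := fun n => ‖Δ n‖ / ρ n) (fun n _ => hterm n)
            (Finset.mem_range.2 hn)
        calc ‖p n z - p n z'‖ ≤ dist z z' * (‖Δ n‖ / ρ n) := hsub n z z'
          _ ≤ dist z z' * (C + 1) := mul_le_mul_of_nonneg_left (by linarith) dist_nonneg
          _ < ε / (C + 1) * (C + 1) := mul_lt_mul_of_pos_right hz (by positivity)
          _ = ε := by field_simp
      · exact (hsub' n z z').trans_lt (hN n hn))
  refine ⟨P, hP, fun n => ?_, fun z hz => h2 z fun n => hzero n z (hz n)⟩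
  by_cases h0 : Δ n = 0
  · rw [h0]
    refine h2 _ fun m => ?_
    by_cases hmn : m = n
    · subst hmn; rw [hself, h0]
    · refine hzero _ _ ?_
      have := hdis n m (Ne.symm hmn)
      linarith [hρ n]
  · rw [h1 n (x n) (by rwa [hself]), hself]

/-! ### Chain distances and interpolation along `u`-sequences. -/

theorem chainDist_self (ε : ℝ) (a : X) : chainDist ε a a = 0 := by
  refine le_antisymm ?_ zero_le
  exact iInf_le_of_le 0 (iInf_le_of_le (fun _ => a) (iInf_le_of_le
    ⟨rfl, rfl, fun i hi => absurd hi (Nat.not_lt_zero i)⟩ (by simp)))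

theorem edist_le_chainDist (ε : ℝ) (a b : X) : edist a b ≤ chainDist ε a b := by
  refine le_iInf fun n => le_iInf fun c => le_iInf fun hc => ?_
  rw [← hc.1, ← hc.2.1]
  exact edist_le_range_sum_edist c n

theorem chainDist_le_add_edist {ε : ℝ} (a : X) {z z' : X} (h : dist z z' ≤ ε) :
    chainDist ε a z' ≤ chainDist ε a z + edist z z' := by
  rw [← tsub_le_iff_right]
  refine le_iInf fun n => le_iInf fun c => le_iInf fun hc => ?_
  rw [tsub_le_iff_right]
  refine iInf_le_of_le (n + 1) (iInf_le_of_le (fun i => if i ≤ n then c i else z')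
    (iInf_le_of_le ⟨by simp [hc.1], by simp, fun i hi => ?_⟩ ?_))
  · rcases Nat.lt_succ_iff_lt_or_eq.1 hi with hi | rfl
    · simpa [hi.le, Nat.succ_le_of_lt hi] using hc.2.2 i hi
    · simpa [hc.2.1] using h
  · rw [Finset.sum_range_succ]
    refine le_of_eq ?_
    congr 1
    · refine Finset.sum_congr rfl fun i hi => ?_
      have hi := Finset.mem_range.1 hi
      simp [hi.le, Nat.succ_le_of_lt hi]
    · simp [hc.2.1]

theorem chainDist_le_add_chainDist (ε : ℝ) (a b z : X) :
    chainDist ε a b ≤ chainDist ε a z + chainDist ε b z := by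
  rw [← tsub_le_iff_left]
  refine le_iInf fun n => le_iInf fun c => le_iInf fun hc => ?_
  rw [tsub_le_iff_left]
  obtain ⟨h0, hn, hc⟩ := hc
  have key : ∀ k ≤ n, chainDist ε a (c 0) ≤ chainDist ε a (c k) +
      ∑ i ∈ Finset.range k, edist (c i) (c (i + 1)) := by
    intro k
    induction k with
    | zero => simp
    | succ k ih =>
      intro hk
      refine (ih (by omega)).trans ?_
      rw [Finset.sum_range_succ, add_comm (∑ i ∈ Finset.range k, _), ← add_assoc]
      gcongr
      rw [edist_comm]
      exact chainDist_le_add_edist a (by rw [dist_comm]; exact hc k (by omega))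
  have := key n le_rfl
  rwa [h0, hn] at this

/-- Interpolation at points whose `d_ε`-balls of radius comparable to the values are disjoint. -/
theorem exists_interpolation_of_chainDist {x : ℕ → X} {e : ℕ → E} {R : ℕ → ℝ} {ε K : ℝ}
    (hε : 0 < ε) (hR : ∀ n, 0 < R n)
    (hdis : ∀ m n, m ≠ n → ENNReal.ofReal (R m + R n) ≤ chainDist ε (x m) (x n))
    (he : ∀ n, ‖e n‖ ≤ K * R n) :
    ∃ f : X → E, UniformContinuous f ∧ ∀ n, f (x n) = e n := by
  -- A tent of slope one for `d_ε`; truncated subtraction makes it `0` where the chain distance is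
  -- at least `R n`, including `∞`.
  set b : ℕ → X → ℝ := fun n z => (ENNReal.ofReal (R n) - chainDist ε (x n) z).toReal with hb
  set p : ℕ → X → E := fun n z => (b n z / R n) • e n with hp
  have hK : 0 ≤ K := by
    by_contra! hc
    linarith [(norm_nonneg _).trans (he 0), mul_neg_of_neg_of_pos hc (hR 0)]
  have hself : ∀ n, p n (x n) = e n := by
    intro n
    simp only [hp, hb]
    rw [chainDist_self, tsub_zero, ENNReal.toReal_ofReal (hR n).le, div_self (hR n).ne', one_smul]
  have hlt : ∀ n z, p n z ≠ 0 → chainDist ε (x n) z < ENNReal.ofReal (R n) := by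
    intro n z h
    by_contra hc
    refine h ?_
    simp only [hp, hb]
    rw [tsub_eq_zero_of_le (not_lt.1 hc)]
    simp
  have hb1 : ∀ n z z', dist z z' ≤ ε → b n z ≤ b n z' + dist z z' := by
    intro n z z' h
    simp only [hb]
    have hfin : ENNReal.ofReal (R n) - chainDist ε (x n) z' ≠ ∞ :=
      ne_top_of_le_ne_top ENNReal.ofReal_ne_top tsub_le_self
    rw [dist_edist, ← ENNReal.toReal_add hfin (edist_ne_top _ _)]
    refine ENNReal.toReal_mono (ENNReal.add_ne_top.2 ⟨hfin, edist_ne_top _ _⟩) ?_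
    rw [tsub_le_iff_right, add_assoc]
    refine (le_tsub_add (a := chainDist ε (x n) z')).trans ?_
    gcongr
    rw [add_comm]
    exact chainDist_le_add_edist _ h
  have hsub : ∀ n z z', dist z z' ≤ ε → ‖p n z - p n z'‖ ≤ dist z z' * K := by
    intro n z z' h
    simp only [hp]
    rw [← sub_smul, norm_smul, Real.norm_eq_abs, ← sub_div, abs_div, abs_of_pos (hR n)]
    have h1 : |b n z - b n z'| ≤ dist z z' := by
      have h2 := hb1 n z' z (by rwa [dist_comm])
      rw [dist_comm] at h2
      rw [abs_le]
      constructor <;> linarith [hb1 n z z' h]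
    calc |b n z - b n z'| / R n * ‖e n‖ ≤ dist z z' / R n * (K * R n) :=
          mul_le_mul (div_le_div_of_nonneg_right h1 (hR n).le) (he n) (norm_nonneg _)
            (div_nonneg dist_nonneg (hR n).le)
      _ = dist z z' * K := by have := (hR n).ne'; field_simp
  obtain ⟨P, hP, h1, h2⟩ := exists_sum_of_disjoint (p := p)
    (by
      intro m n z hm hn
      by_contra hmn
      have h1 := (hdis m n hmn).trans (chainDist_le_add_chainDist ε (x m) (x n) z)
      rw [ENNReal.ofReal_add (hR m).le (hR n).le] at h1
      exact absurd h1 (not_le.2 (ENNReal.add_lt_add (hlt m z hm) (hlt n z hn))))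
    (by
      intro η hη
      refine ⟨min ε (η / (K + 1)), by positivity, fun n z z' hz => ?_⟩
      calc ‖p n z - p n z'‖ ≤ dist z z' * K :=
            hsub n z z' (hz.le.trans (min_le_left _ _))
        _ ≤ dist z z' * (K + 1) := mul_le_mul_of_nonneg_left (by linarith) dist_nonneg
        _ < η / (K + 1) * (K + 1) :=
            mul_lt_mul_of_pos_right (lt_of_lt_of_le hz (min_le_right _ _)) (by positivity)
        _ = η := by field_simp)
  refine ⟨P, hP, fun n => ?_⟩
  by_cases h0 : e n = 0
  · rw [h0]
    refine h2 _ fun m => ?_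
    by_cases hmn : m = n
    · subst hmn; rw [hself, h0]
    · by_contra hc
      refine absurd (hdis m n hmn) (not_le.2 ((hlt m _ hc).trans_le ?_))
      exact ENNReal.ofReal_le_ofReal (by linarith [hR n])
  · rw [h1 n (x n) (by rwa [hself]), hself]

/-- A subsequence of a `u`-sequence lies on the graph of a uniformly continuous function. -/
theorem IsUSeq.exists_interpolation {x : ℕ → X} {e : ℕ → E} (h : IsUSeq x e) :
    ∃ σ : ℕ → ℕ, StrictMono σ ∧
      ∃ f : X → E, UniformContinuous f ∧ ∀ n, f (x (σ n)) = e (σ n) := by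
  obtain ⟨⟨r, hr, hsep⟩, ε, hε, C, hC⟩ := h
  by_cases hb : ∃ M, ∃ᶠ n in atTop, ‖e n‖ ≤ M
  · obtain ⟨M, hM⟩ := hb
    obtain ⟨σ, hσ, hM⟩ := extraction_of_frequently_atTop hM
    refine ⟨σ, hσ, exists_interpolation_of_chainDist (x := x ∘ σ) (e := e ∘ σ)
      (R := fun _ => r / 2) (K := 2 * M / r) hε (fun _ => by positivity) (fun m n hmn => ?_)
      fun n => (hM n).trans_eq (by field_simp)⟩
    refine le_trans ?_ (edist_le_chainDist _ _ _)
    rw [edist_dist, add_halves]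
    exact ENNReal.ofReal_le_ofReal (hsep _ _ (hσ.injective.ne hmn))
  · push Not at hb
    -- Growth by the factor `4` gives `‖e m‖ + ‖e n‖ ≤ 2 ‖e n - e m‖`, so the `u`-condition makes
    -- the radii `‖e n‖ / (2 (C + 1))` admissible; `C + 1` avoids dividing by zero.
    obtain ⟨σ, hσ1, hσ⟩ := exists_seq_of_forall_finset_exists (fun n : ℕ => 1 < ‖e n‖)
      (fun m n => m < n ∧ 4 * ‖e m‖ < ‖e n‖) (by
        intro s _
        have h1 : ∀ᶠ n in atTop, ∀ m ∈ s, m < n ∧ 4 * ‖e m‖ < ‖e n‖ :=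
          (Filter.eventually_all_finset s).2 fun m _ => (eventually_gt_atTop m).and (hb _)
        exact ((hb 1).and h1).exists)
    have hmono : StrictMono σ := fun m n hmn => (hσ m n hmn).1
    refine ⟨σ, hmono, exists_interpolation_of_chainDist (x := x ∘ σ) (e := e ∘ σ)
      (R := fun n => ‖e (σ n)‖ / (2 * (C + 1))) (K := 2 * (C + 1)) hε
      (fun n => div_pos (by linarith [hσ1 n]) (by positivity)) ?_
      fun n => le_of_eq (by simp only [Function.comp]; field_simp)⟩
    have key : ∀ m n : ℕ, 4 * ‖e (σ m)‖ < ‖e (σ n)‖ ∨ 4 * ‖e (σ n)‖ < ‖e (σ m)‖ →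
        ENNReal.ofReal (‖e (σ m)‖ / (2 * (C + 1)) + ‖e (σ n)‖ / (2 * (C + 1))) ≤
          chainDist ε (x (σ m)) (x (σ n)) := by
      intro m n hmn
      have h1 : ‖e (σ m)‖ + ‖e (σ n)‖ ≤ 2 * ‖e (σ n) - e (σ m)‖ := by
        rcases hmn with hmn | hmn
        · linarith [norm_sub_norm_le (e (σ n)) (e (σ m)), norm_nonneg (e (σ m))]
        · have := norm_sub_norm_le (e (σ m)) (e (σ n))
          rw [norm_sub_rev] at this
          linarith [norm_nonneg (e (σ n))]
      have hpos : (0 : ℝ) < C + 1 := by positivity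
      have h2 : ENNReal.ofReal ‖e (σ n) - e (σ m)‖ ≤
          ((C + 1 : ℝ≥0) : ℝ≥0∞) * chainDist ε (x (σ m)) (x (σ n)) := by
        have h3 := hC (σ n) (σ m)
        rw [norm_sub_rev] at h3
        refine h3.trans ?_
        gcongr
        simp
      have h5 : ENNReal.ofReal (‖e (σ m)‖ / (2 * (C + 1)) + ‖e (σ n)‖ / (2 * (C + 1))) ≤
          ENNReal.ofReal (‖e (σ n) - e (σ m)‖ / (C + 1)) := by
        refine ENNReal.ofReal_le_ofReal ?_
        rw [← add_div, div_le_div_iff₀ (by positivity) hpos]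
        nlinarith
      refine h5.trans ?_
      rw [ENNReal.ofReal_div_of_pos hpos]
      refine ENNReal.div_le_of_le_mul' ?_
      have e1 : ENNReal.ofReal ((C : ℝ) + 1) = ((C + 1 : ℝ≥0) : ℝ≥0∞) := by
        rw [ENNReal.ofReal, Real.toNNReal_add C.coe_nonneg zero_le_one]; simp
      rwa [e1]
    intro m n hmn
    rcases lt_or_gt_of_ne hmn with h | h
    · exact key m n (Or.inl (hσ m n h).2)
    · exact key m n (Or.inr (hσ n m h).2)

end Bumps

/-! ### Uniform continuity of the point map. -/

section UniformMap

variable {X Y E F : Type*} [MetricSpace X] [MetricSpace Y]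
  [NormedAddCommGroup E] [NormedAddCommGroup F]

theorem IsSeparatedSeq.exists_eventually_le_dist {y : ℕ → Y} (hy : IsSeparatedSeq y) :
    ∃ r > 0, ∀ p, ∀ᶠ n in atTop, r ≤ dist (y n) p := by
  obtain ⟨r, hr, hsep⟩ := hy
  refine ⟨r / 2, by positivity, fun p => ?_⟩
  by_contra hc
  rw [not_eventually, frequently_atTop] at hc
  obtain ⟨m, -, hm⟩ := hc 0
  obtain ⟨n, hn, hn'⟩ := hc (m + 1)
  have := hsep m n (by omega)
  linarith [dist_triangle_right (y m) (y n) p]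

/-- Two separated sequences with `d(y_n, y'_n)` bounded below have subsequences whose ranges are
uniformly separated. -/
theorem exists_subseq_separated_ranges {y y' : ℕ → Y} (hy : IsSeparatedSeq y)
    (hy' : IsSeparatedSeq y') {ε : ℝ} (hε : 0 < ε) (h : ∀ n, ε ≤ dist (y n) (y' n)) :
    ∃ σ : ℕ → ℕ, StrictMono σ ∧ ∃ s > 0, ∀ m n, s ≤ dist (y (σ m)) (y' (σ n)) := by
  obtain ⟨r, hr, hr1⟩ := hy.exists_eventually_le_dist
  obtain ⟨r', hr', hr1'⟩ := hy'.exists_eventually_le_dist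
  obtain ⟨σ, -, hσ⟩ := exists_seq_of_forall_finset_exists (fun _ : ℕ => True)
    (fun m n => m < n ∧ r ≤ dist (y n) (y' m) ∧ r' ≤ dist (y' n) (y m)) (by
      intro s _
      have h1 : ∀ᶠ n in atTop, ∀ m ∈ s, m < n ∧ r ≤ dist (y n) (y' m) ∧ r' ≤ dist (y' n) (y m) :=
        (Filter.eventually_all_finset s).2 fun m _ =>
          (eventually_gt_atTop m).and ((hr1 _).and (hr1' _))
      obtain ⟨n, hn⟩ := h1.exists
      exact ⟨n, trivial, hn⟩)
  refine ⟨σ, fun m n hmn => (hσ m n hmn).1, min ε (min r r'), by positivity, fun m n => ?_⟩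
  rcases lt_trichotomy m n with hmn | rfl | hmn
  · rw [dist_comm]
    exact ((min_le_right _ _).trans (min_le_right _ _)).trans (hσ m n hmn).2.2
  · exact (min_le_left _ _).trans (h _)
  · exact ((min_le_right _ _).trans (min_le_left _ _)).trans (hσ n m hmn).2.1

theorem tendsto_dist_zero_of_uniformContinuous {Z W : Type*} [PseudoMetricSpace Z]
    [PseudoMetricSpace W] {f : Z → W} (hf : UniformContinuous f) {a b : ℕ → Z}
    (h : Tendsto (fun n => dist (a n) (b n)) atTop (𝓝 0)) :
    Tendsto (fun n => dist (f (a n)) (f (b n))) atTop (𝓝 0) :=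
  tendsto_uniformity_iff_dist_tendsto_zero (f := fun n => (f (a n), f (b n))).1
    (Tendsto.comp hf (tendsto_uniformity_iff_dist_tendsto_zero (f := fun n => (a n, b n)).2 h))

theorem not_uniformContinuous_exists_seq {f : X → Y} (hf : ¬ UniformContinuous f) :
    ∃ ε > 0, ∃ a b : ℕ → X, Tendsto (fun n => dist (a n) (b n)) atTop (𝓝 0) ∧
      ∀ n, ε ≤ dist (f (a n)) (f (b n)) := by
  rw [Metric.uniformContinuous_iff] at hf
  push Not at hf
  obtain ⟨ε, hε, hf⟩ := hf
  choose a b hab hf using fun n : ℕ => hf (1 / ((n : ℝ) + 1)) (by positivity)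
  exact ⟨ε, hε, a, b, squeeze_zero (fun _ => dist_nonneg) (fun n => (hab n).le)
    tendsto_one_div_add_atTop_nhds_zero_nat, hf⟩

/-- If `φ ∘ a` had a convergent subsequence, `a` and `b` would converge along it to the same point,
and their images could not stay `ε` apart. -/
theorem exists_subseq_separated_image [CompleteSpace Y] (φ : X ≃ₜ Y) {a b : ℕ → X}
    (hab : Tendsto (fun n => dist (a n) (b n)) atTop (𝓝 0)) {ε : ℝ} (hε : 0 < ε)
    (h : ∀ n, ε ≤ dist (φ (a n)) (φ (b n))) :
    ∃ σ : ℕ → ℕ, StrictMono σ ∧ IsSeparatedSeq (φ ∘ a ∘ σ) := by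
  rcases exists_subseq_tendsto_or_separated (φ ∘ a) with ⟨y, σ, hσ, hlim⟩ | ⟨σ, hσ, hsep⟩
  · exfalso
    have ha : Tendsto (a ∘ σ) atTop (𝓝 (φ.symm y)) := by
      have := (φ.symm.continuous.tendsto y).comp hlim
      simpa [Function.comp_def] using this
    have hb : Tendsto (b ∘ σ) atTop (𝓝 (φ.symm y)) :=
      (tendsto_iff_of_dist (hab.comp hσ.tendsto_atTop)).1 ha
    have h1 := ((φ.continuous.tendsto _).comp ha).dist ((φ.continuous.tendsto _).comp hb)
    rw [dist_self] at h1
    obtain ⟨n, hn⟩ := (h1.eventually_lt_const hε).exists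
    exact absurd (h (σ n)) (not_le.2 hn)
  · exact ⟨σ, hσ, hsep⟩

theorem uniformContinuous_piecewise_of_isolated {k₁ k₂ : Y → F} (h₂ : UniformContinuous k₂)
    {S : Set Y} {δ : ℝ} (hδ : 0 < δ) (hS : ∀ y ∈ S, ∀ z, dist z y < δ → z = y) :
    ∃ g : Y → F, UniformContinuous g ∧ (∀ y ∈ S, g y = k₁ y) ∧ ∀ y ∉ S, g y = k₂ y := by
  classical
  refine ⟨fun y => if y ∈ S then k₁ y else k₂ y, Metric.uniformContinuous_iff.2 fun ε hε => ?_,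
    fun y hy => if_pos hy, fun y hy => if_neg hy⟩
  obtain ⟨δ', hδ', hd⟩ := Metric.uniformContinuous_iff.1 h₂ ε hε
  refine ⟨min δ δ', by positivity, fun {a b} hab => ?_⟩
  have h1 := lt_of_lt_of_le hab (min_le_left _ _)
  by_cases ha : a ∈ S
  · rw [hS a ha b (by rwa [dist_comm]), dist_self]
    exact hε
  · by_cases hb : b ∈ S
    · rw [hS b hb a h1, dist_self]
      exact hε
    · simp only [if_neg ha, if_neg hb]
      exact hd (lt_of_lt_of_le hab (min_le_right _ _))

variable [NormedSpace ℝ E] [NormedSpace ℝ F] [Nontrivial E] [Nontrivial F]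

/-- Suppose `a n` and `b n` get close while their images stay apart. If infinitely many `φ (a n)`
are uniformly isolated, values can be changed freely there, and a pullback jumps between `a n` and
`b n`. If not, there are points `w n ≠ φ (a n)` ever closer to `φ (a n)`, and some image jumps
between these two. -/
theorem uniformContinuous_of_forall_apply_eq_iff [CompleteSpace X] [CompleteSpace Y]
    (T : UC X E ≃ UC Y F) (φ : X ≃ₜ Y)
    (hφ : ∀ (f h : UC X E) (x : X), f.1 x = h.1 x ↔ (T f).1 (φ x) = (T h).1 (φ x)) :
    UniformContinuous φ := by
  have hφ' : ∀ (f h : UC Y F) (x : X), f.1 (φ x) = h.1 (φ x) ↔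
      (T.symm f).1 x = (T.symm h).1 x := fun f h x => by rw [hφ]; simp
  by_contra hc
  -- extract separated sequences that witness the failure
  obtain ⟨ε, hε, a₀, b₀, hab₀, h₀⟩ := not_uniformContinuous_exists_seq hc
  obtain ⟨σ₁, hσ₁, hs₁⟩ := exists_subseq_separated_image φ hab₀ hε h₀
  obtain ⟨σ₂, hσ₂, hs₂⟩ := exists_subseq_separated_image φ (a := b₀ ∘ σ₁) (b := a₀ ∘ σ₁)
    (by simpa only [Function.comp_def, dist_comm] using hab₀.comp hσ₁.tendsto_atTop) hε
    (fun n => by rw [dist_comm]; exact h₀ _)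
  have hab₂ : Tendsto (fun n => dist (a₀ (σ₁ (σ₂ n))) (b₀ (σ₁ (σ₂ n)))) atTop (𝓝 0) :=
    hab₀.comp (hσ₁.comp hσ₂).tendsto_atTop
  obtain ⟨σ₃, hσ₃, s, hs, hsep₃⟩ := exists_subseq_separated_ranges (hs₁.comp_strictMono hσ₂) hs₂
    hε (fun n => h₀ _)
  obtain ⟨a, b, hab, hasep, hcross⟩ : ∃ a b : ℕ → X,
      Tendsto (fun n => dist (a n) (b n)) atTop (𝓝 0) ∧ IsSeparatedSeq (φ ∘ a) ∧
        ∀ m n, s ≤ dist (φ (a m)) (φ (b n)) :=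
    ⟨_, _, hab₂.comp hσ₃.tendsto_atTop, (hs₁.comp_strictMono hσ₂).comp_strictMono hσ₃, hsep₃⟩
  clear hsep₃ hab₂ hs₂ hs₁ hab₀ h₀
  by_cases hiso : ∃ δ > 0, ∃ᶠ n in atTop, ∀ z, dist z (φ (a n)) < δ → z = φ (a n)
  · obtain ⟨δ, hδ, hfreq⟩ := hiso
    obtain ⟨σ, hσ, hiso⟩ := extraction_of_frequently_atTop hfreq
    obtain ⟨e, he⟩ := exists_ne (0 : E)
    obtain ⟨g, hg, hg1, hg2⟩ := uniformContinuous_piecewise_of_isolated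
      (k₁ := (T (UC.const X e)).1) (T (UC.const X 0)).2
      (S := Set.range fun n => φ (a (σ n))) hδ (by rintro _ ⟨n, rfl⟩; exact hiso n)
    have h1 : ∀ n, (T.symm ⟨g, hg⟩).1 (a (σ n)) = e := fun n => by
      have := (hφ' ⟨g, hg⟩ (T (UC.const X e)) (a (σ n))).1 (hg1 _ ⟨n, rfl⟩)
      rw [T.symm_apply_apply] at this
      exact this
    have h2 : ∀ n, (T.symm ⟨g, hg⟩).1 (b (σ n)) = 0 := fun n => by
      have := (hφ' ⟨g, hg⟩ (T (UC.const X 0)) (b (σ n))).1 (hg2 _ (by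
        rintro ⟨m, hm⟩
        have := hcross (σ m) (σ n)
        rw [show φ (a (σ m)) = φ (b (σ n)) from hm, dist_self] at this
        linarith))
      rw [T.symm_apply_apply] at this
      exact this
    have h3 := tendsto_dist_zero_of_uniformContinuous (T.symm ⟨g, hg⟩).2
      (hab.comp hσ.tendsto_atTop)
    simp only [h1, h2, dist_zero_right] at h3
    exact he (norm_eq_zero.1 (tendsto_nhds_unique tendsto_const_nhds h3))
  · push Not at hiso
    obtain ⟨v, hv⟩ := exists_ne (0 : F)
    obtain ⟨r, hr, hrsep⟩ := id hasep
    obtain ⟨σ, hσ, hnear⟩ := extraction_forall_of_eventually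
      fun k : ℕ => hiso (min (r / 2) (1 / ((k : ℝ) + 1))) (by positivity)
    choose w hw hwne using hnear
    obtain ⟨g, hg, hg1, hg2⟩ := exists_glue_of_dist (k₁ := fun _ : Y => v) (k₂ := fun _ => 0)
      (A := Set.range fun n => φ (a n)) (B := Set.range fun n => φ (b n))
      uniformContinuous_const uniformContinuous_const hs
      (by rintro _ ⟨m, rfl⟩ _ ⟨n, rfl⟩; exact hcross m n) (M := ‖v‖) (by simp)
    set h : UC X E := T.symm (UC.const Y 0) with hh
    set f : UC X E := T.symm ⟨g, hg⟩ with hf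
    -- The difference `f - h` vanishes at `b n`, so its values at the nearby `a n` tend to `0` and
    -- can serve as heights of arbitrarily narrow bumps.
    have hΔ : Tendsto (fun n => f.1 (a n) - h.1 (a n)) atTop (𝓝 0) := by
      have h1 : UniformContinuous fun x => f.1 x - h.1 x := UniformContinuous.sub f.2 h.2
      have h2 := tendsto_dist_zero_of_uniformContinuous h1 hab
      have h3 : ∀ n, f.1 (b n) - h.1 (b n) = 0 := fun n =>
        sub_eq_zero.2 ((hφ' ⟨g, hg⟩ (UC.const Y 0) (b n)).1 (hg2 _ ⟨n, rfl⟩).self_of_nhds)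
      simp only [h3, dist_zero_right] at h2
      exact tendsto_zero_iff_norm_tendsto_zero.2 h2
    -- the points `φ.symm (w n)` stay away from each `a m`
    have hfar : ∀ m, ∃ ρ > 0, ∀ n, ρ ≤ dist (φ.symm (w n)) (a (σ m)) := by
      intro m
      have hpos : 0 < min (r / 2) (dist (w m) (φ (a (σ m)))) :=
        lt_min (by positivity) (dist_pos.2 (hwne m))
      obtain ⟨ρ, hρ, hd⟩ := Metric.continuous_iff.1 φ.continuous (a (σ m)) _ hpos
      refine ⟨ρ, hρ, fun n => ?_⟩
      by_contra! hlt
      have h1 := hd _ hlt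
      rw [φ.apply_symm_apply, lt_min_iff] at h1
      by_cases hmn : n = m
      · subst hmn
        exact lt_irrefl _ h1.2
      · have h2 := hrsep (σ n) (σ m) (hσ.injective.ne hmn)
        have h3 := (hw n).trans_le (min_le_left _ _)
        have h4 := dist_triangle_left (φ (a (σ n))) (φ (a (σ m))) (w n)
        simp only [Function.comp_apply] at h2
        linarith [h1.1]
    choose ρ hρ hρw using hfar
    have hasep' : ∃ τ : ℕ → ℕ, StrictMono τ ∧ IsSeparatedSeq (a ∘ σ ∘ τ) := by
      rcases exists_subseq_tendsto_or_separated (a ∘ σ) with ⟨x, τ, hτ, hlim⟩ | h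
      · exfalso
        have h1 := (φ.continuous.tendsto _).comp hlim
        obtain ⟨r', hr', hev⟩ := (hasep.comp_strictMono (hσ.comp hτ)).exists_eventually_le_dist
        obtain ⟨n, hn1, hn2⟩ := ((hev (φ x)).and
          (h1.eventually (Metric.ball_mem_nhds _ hr'))).exists
        exact absurd hn1 (not_le.2 hn2)
      · exact h
    obtain ⟨τ, hτ, t, ht, htsep⟩ := hasep'
    obtain ⟨p, hp, hp1, hp2⟩ := exists_bumps (x := a ∘ σ ∘ τ)
      (ρ := fun n => min (t / 2) (ρ (τ n))) (fun n => lt_min (by positivity) (hρ _))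
      (fun m n hmn => by
        have := htsep m n hmn
        linarith [min_le_left (t / 2) (ρ (τ m)), min_le_left (t / 2) (ρ (τ n))])
      (hΔ.comp (hσ.comp hτ).tendsto_atTop)
    -- This function has the value of `f` at `a n` and that of `h` at the preimage of `w n`, so `T
    -- k` passes from `v` to `0` over vanishing distances.
    set k : UC X E := ⟨fun x => h.1 x + p x, UniformContinuous.add h.2 hp⟩ with hk
    have hk1 : ∀ n, (T k).1 (φ (a (σ (τ n)))) = v := fun n => by
      have h1 : k.1 (a (σ (τ n))) = f.1 (a (σ (τ n))) := by
        have := hp1 n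
        simp only [Function.comp_apply] at this
        simp [hk, this]
      have h2 := (hφ k f _).1 h1
      rw [hf, T.apply_symm_apply] at h2
      exact h2.trans (hg1 _ ⟨_, rfl⟩).self_of_nhds
    have hk2 : ∀ n, (T k).1 (w (τ n)) = 0 := fun n => by
      have h1 : k.1 (φ.symm (w (τ n))) = h.1 (φ.symm (w (τ n))) := by
        simp [hk, hp2 _ fun m => (min_le_right _ _).trans (hρw (τ m) (τ n))]
      have h2 := (hφ k h _).1 h1
      rw [hh, T.apply_symm_apply, φ.apply_symm_apply] at h2
      exact h2
    have hlim : Tendsto (fun n => dist (φ (a (σ (τ n)))) (w (τ n))) atTop (𝓝 0) := by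
      refine squeeze_zero (fun _ => dist_nonneg) (fun n => ?_)
        (tendsto_one_div_add_atTop_nhds_zero_nat.comp hτ.tendsto_atTop)
      rw [dist_comm]
      exact (hw (τ n)).le.trans (min_le_right _ _)
    have h3 := tendsto_dist_zero_of_uniformContinuous (T k).2 hlim
    simp only [hk1, hk2, dist_zero_right] at h3
    exact hv (norm_eq_zero.1 (tendsto_nhds_unique tendsto_const_nhds h3))

end UniformMap

/-! ### Continuity properties of `Φ` and `Ψ`. -/

section Representation

variable {X Y E F : Type*} [MetricSpace X] [MetricSpace Y]
  [NormedAddCommGroup E] [NormedAddCommGroup F]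

theorem mem_derivedSet_univ_iff {Z : Type*} [TopologicalSpace Z] {z : Z} :
    z ∈ derivedSet (Set.univ : Set Z) ↔ 𝓝[≠] z ≠ ⊥ := by
  rw [mem_derivedSet, AccPt, principal_univ, inf_top_eq, neBot_iff]

theorem homeomorph_apply_mem_derivedSet_univ {Z W : Type*} [TopologicalSpace Z]
    [TopologicalSpace W] (φ : Z ≃ₜ W) {z : Z} (hz : z ∈ derivedSet (Set.univ : Set Z)) :
    φ z ∈ derivedSet (Set.univ : Set W) := by
  rw [mem_derivedSet_univ_iff, ne_eq, ← isOpen_singleton_iff_punctured_nhds] at hz ⊢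
  rwa [← Set.image_singleton, φ.isOpen_image]

theorem apply_eq_const_apply (T : UC X E → UC Y F) (φ : X ≃ Y)
    (hφ : ∀ (f h : UC X E) (x : X), f.1 x = h.1 x → (T f).1 (φ x) = (T h).1 (φ x))
    (f : UC X E) (y : Y) : (T f).1 y = (T (UC.const X (f.1 (φ.symm y)))).1 y := by
  have := hφ f (UC.const X (f.1 (φ.symm y))) (φ.symm y) rfl
  rwa [φ.apply_symm_apply] at this

variable [NormedSpace ℝ E]

/-- A sequence violating continuity can be put on the graph of a single uniformly continuous `f`
through `(φ.symm y₀, e₀)`, contradicting continuity of `T f` at `y₀`. -/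
theorem continuousAt_apply_const (T : UC X E → UC Y F) (φ : X ≃ₜ Y)
    (hφ : ∀ (f h : UC X E) (x : X), f.1 x = h.1 x → (T f).1 (φ x) = (T h).1 (φ x))
    {y₀ : Y} (hy₀ : y₀ ∈ derivedSet (Set.univ : Set Y)) (e₀ : E) :
    ContinuousAt (fun p : Y × E => (T (UC.const X p.2)).1 p.1) (y₀, e₀) := by
  rw [mem_derivedSet_univ_iff, ← neBot_iff] at hy₀
  by_contra hc
  rw [Metric.continuousAt_iff] at hc
  push Not at hc
  obtain ⟨δ, hδ, hc⟩ := hc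
  have hstep : ∀ η > 0, ∃ (y : Y) (e : E), y ≠ y₀ ∧ dist y y₀ < η ∧ dist e e₀ < η ∧
      δ / 2 ≤ dist ((T (UC.const X e)).1 y) ((T (UC.const X e₀)).1 y₀) := by
    intro η hη
    obtain ⟨⟨y, e⟩, hye, hd⟩ := hc η hη
    rw [Prod.dist_eq, max_lt_iff] at hye
    simp only at hd hye
    -- A bad point over `y₀` itself is moved to a nearby `z ≠ y₀`, at the cost of half of `δ`.
    by_cases hy : y = y₀
    · subst hy
      have h1 : ∀ᶠ z in 𝓝[≠] y, dist ((T (UC.const X e)).1 z) ((T (UC.const X e)).1 y) < δ / 2 :=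
        nhdsWithin_le_nhds (((UC.continuous (T (UC.const X e))).tendsto y).eventually
          (Metric.ball_mem_nhds _ (by positivity)))
      have h2 : ∀ᶠ z in 𝓝[≠] y, dist z y < η :=
        nhdsWithin_le_nhds (Metric.ball_mem_nhds y hη)
      have h3 : ∀ᶠ z in 𝓝[≠] y, z ≠ y := self_mem_nhdsWithin
      obtain ⟨z, hz1, hz2, hz3⟩ := (h1.and (h2.and h3)).exists
      refine ⟨z, e, hz3, hz2, hye.2, ?_⟩
      have := dist_triangle_left ((T (UC.const X e)).1 y) ((T (UC.const X e₀)).1 y)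
        ((T (UC.const X e)).1 z)
      linarith
    · exact ⟨y, e, hy, hye.1, hye.2, by linarith⟩
  choose y e hyne hy he hd using fun n : ℕ => hstep (1 / ((n : ℝ) + 1)) (by positivity)
  have hylim : Tendsto y atTop (𝓝 y₀) := tendsto_iff_dist_tendsto_zero.2
    (squeeze_zero (fun _ => dist_nonneg) (fun n => (hy n).le)
      tendsto_one_div_add_atTop_nhds_zero_nat)
  have helim : Tendsto e atTop (𝓝 e₀) := tendsto_iff_dist_tendsto_zero.2
    (squeeze_zero (fun _ => dist_nonneg) (fun n => (he n).le)
      tendsto_one_div_add_atTop_nhds_zero_nat)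
  set x : ℕ → X := fun n => φ.symm (y n) with hx
  set x₀ := φ.symm y₀ with hx₀
  have hxlim : Tendsto x atTop (𝓝 x₀) := (φ.symm.continuous.tendsto y₀).comp hylim
  have hxpos : ∀ n, 0 < dist (x n) x₀ := fun n =>
    dist_pos.2 fun h => hyne n (φ.symm.injective h)
  -- Since distances to `x₀` drop by a factor `4`, balls of a quarter of these radii are disjoint
  -- and miss `x₀`.
  obtain ⟨σ, -, hσ⟩ := exists_seq_of_forall_finset_exists (fun _ : ℕ => True)
    (fun m n => m < n ∧ dist (x n) x₀ < dist (x m) x₀ / 4) (by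
      intro s _
      have h1 : ∀ᶠ n in atTop, ∀ m ∈ s, m < n ∧ dist (x n) x₀ < dist (x m) x₀ / 4 :=
        (Filter.eventually_all_finset s).2 fun m _ => (eventually_gt_atTop m).and
          (hxlim.eventually (Metric.ball_mem_nhds _ (by linarith [hxpos m])))
      obtain ⟨n, hn⟩ := h1.exists
      exact ⟨n, trivial, hn⟩)
  have hmono : StrictMono σ := fun m n hmn => (hσ m n hmn).1
  have key : ∀ m n, m < n →
      dist (x (σ m)) x₀ / 4 + dist (x (σ n)) x₀ / 4 ≤ dist (x (σ m)) (x (σ n)) := by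
    intro m n hmn
    linarith [(hσ m n hmn).2, dist_triangle (x (σ m)) (x (σ n)) x₀, hxpos (σ m)]
  obtain ⟨p, hp, hp1, hp2⟩ := exists_bumps (x := x ∘ σ) (ρ := fun n => dist (x (σ n)) x₀ / 4)
    (fun n => by linarith [hxpos (σ n)])
    (by
      intro m n hmn
      rcases lt_or_gt_of_ne hmn with h | h
      · exact key m n h
      · simp only [Function.comp_apply]
        rw [add_comm, dist_comm (x (σ m)) (x (σ n))]
        exact key n m h)
    (Δ := fun n => e (σ n) - e₀)
    (by simpa using (helim.comp hmono.tendsto_atTop).sub_const e₀)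
  set f : UC X E := ⟨fun z => e₀ + p z, UniformContinuous.add uniformContinuous_const hp⟩ with hf
  have hf0 : (T f).1 y₀ = (T (UC.const X e₀)).1 y₀ := by
    have : p x₀ = 0 := hp2 _ fun n => by
      rw [dist_comm x₀]; simp only [Function.comp_apply]; linarith [hxpos (σ n)]
    have hfx : f.1 (φ.toEquiv.symm y₀) = e₀ := by
      show e₀ + p x₀ = e₀
      rw [this, add_zero]
    rw [apply_eq_const_apply T φ.toEquiv hφ f y₀, hfx]
  have hfn : ∀ n, (T f).1 (y (σ n)) = (T (UC.const X (e (σ n)))).1 (y (σ n)) := fun n => by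
    have : p (x (σ n)) = e (σ n) - e₀ := hp1 n
    have hfx : f.1 (φ.toEquiv.symm (y (σ n))) = e (σ n) := by
      show e₀ + p (x (σ n)) = e (σ n)
      rw [this, add_sub_cancel]
    rw [apply_eq_const_apply T φ.toEquiv hφ f (y (σ n)), hfx]
  have hlim := ((UC.continuous (T f)).tendsto y₀).comp (hylim.comp hmono.tendsto_atTop)
  obtain ⟨n, hn⟩ := (hlim.eventually (Metric.ball_mem_nhds _ (half_pos hδ))).exists
  simp only [Function.comp_apply] at hn
  rw [hfn, hf0] at hn
  exact absurd (hd (σ n)) (not_le.2 hn)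

/-- An interpolant through the `u`-sequence, corrected by small bumps at the `x' n`, takes both
prescribed families of values; its image is uniformly continuous. -/
theorem isUContinuous_apply_const (T : UC X E → UC Y F) (φ : X ≃ₜ Y) (huφ : UniformContinuous φ)
    (hφ : ∀ (f h : UC X E) (x : X), f.1 x = h.1 x → (T f).1 (φ x) = (T h).1 (φ x)) :
    IsUContinuous fun p : X × E => (T (UC.const X p.2)).1 (φ p.1) := by
  intro x e hxe x' e' hne hlim
  -- Interpolation is available only along a subsequence, so convergence is checked on further
  -- subsequences.
  refine tendsto_of_subseq_tendsto fun ns hns => ?_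
  obtain ⟨τ, -, hτ⟩ := strictMono_subseq_of_tendsto_atTop hns
  have hxe' : IsUSeq (x ∘ ns ∘ τ) (e ∘ ns ∘ τ) := by
    obtain ⟨hsep, ε, hε, C, hC⟩ := hxe
    exact ⟨hsep.comp_strictMono hτ, ε, hε, C, fun m n => hC _ _⟩
  obtain ⟨σ, hσ, f, hf, hfe⟩ := hxe'.exists_interpolation
  simp only [Function.comp_apply] at hfe
  have hmono : StrictMono (ns ∘ τ ∘ σ) := hτ.comp hσ
  have hdist : Tendsto (fun n => dist (x n) (x' n)) atTop (𝓝 0) :=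
    squeeze_zero (fun _ => dist_nonneg) (fun n => le_add_of_nonneg_right (norm_nonneg _)) hlim
  have hnorm : Tendsto (fun n => ‖e n - e' n‖) atTop (𝓝 0) :=
    squeeze_zero (fun _ => norm_nonneg _) (fun n => le_add_of_nonneg_left dist_nonneg) hlim
  obtain ⟨r, hr, hsep⟩ := hxe.1
  obtain ⟨N, hN⟩ := eventually_atTop.1
    ((hdist.comp hmono.tendsto_atTop).eventually_lt_const (by positivity : 0 < r / 4))
  set κ : ℕ → ℕ := fun n => ns (τ (σ (n + N))) with hκ
  have hκm : StrictMono κ := hmono.comp fun a b h => by show a + N < b + N; omega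
  have hclose : ∀ n, dist (x (κ n)) (x' (κ n)) < r / 4 := fun n => hN _ (Nat.le_add_left _ _)
  have hsep' : ∀ m n, m ≠ n → r ≤ dist (x (κ m)) (x (κ n)) := fun m n h =>
    hsep _ _ (hκm.injective.ne h)
  -- The radii, positive because `x n ≠ x' n`, are as large as possible without disturbing the value
  -- at `x n`.
  obtain ⟨p, hp, hp1, hp2⟩ := exists_bumps (x := x' ∘ κ)
    (ρ := fun n => dist (x (κ n)) (x' (κ n))) (fun n => dist_pos.2 (hne _))
    (by
      intro m n hmn
      have h1 := hsep' m n hmn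
      have h2 := dist_triangle4 (x (κ m)) (x' (κ m)) (x' (κ n)) (x (κ n))
      rw [dist_comm (x' (κ n)) (x (κ n))] at h2
      simp only [Function.comp_apply]
      linarith [hclose m, hclose n])
    (Δ := fun n => e' (κ n) - f (x' (κ n)))
    (by
      have h1 := tendsto_dist_zero_of_uniformContinuous hf (hdist.comp hκm.tendsto_atTop)
      have h2 := h1.add (hnorm.comp hκm.tendsto_atTop)
      rw [add_zero] at h2
      refine squeeze_zero_norm (fun n => ?_) h2
      have h3 : f (x (κ n)) = e (κ n) := hfe (n + N)
      simp only [Function.comp_apply]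
      rw [dist_eq_norm, h3, norm_sub_rev (e (κ n)) (e' (κ n)), add_comm]
      exact norm_sub_le_norm_sub_add_norm_sub _ _ _)
  set g : UC X E := ⟨fun z => f z + p z, UniformContinuous.add hf hp⟩ with hg
  have hg1 : ∀ n, (T (UC.const X (e (κ n)))).1 (φ (x (κ n))) = (T g).1 (φ (x (κ n))) := fun n => by
    refine hφ _ _ _ ?_
    have h1 : p (x (κ n)) = 0 := hp2 _ fun m => by
      by_cases hmn : m = n
      · subst hmn; exact le_rfl
      · have h1 := hsep' m n hmn
        have h2 := dist_triangle_right (x (κ m)) (x (κ n)) (x' (κ m))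
        simp only [Function.comp_apply]
        linarith [hclose m]
    have h3 : f (x (κ n)) = e (κ n) := hfe (n + N)
    show e (κ n) = f (x (κ n)) + p (x (κ n))
    rw [h1, h3, add_zero]
  have hg2 : ∀ n, (T (UC.const X (e' (κ n)))).1 (φ (x' (κ n))) = (T g).1 (φ (x' (κ n))) :=
    fun n => by
      refine hφ _ _ _ ?_
      have h1 : p (x' (κ n)) = _ := hp1 n
      show e' (κ n) = f (x' (κ n)) + p (x' (κ n))
      rw [h1]; abel
  refine ⟨fun n => τ (σ (n + N)), ?_⟩
  have h1 := tendsto_dist_zero_of_uniformContinuous (T g).2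
    (tendsto_dist_zero_of_uniformContinuous huφ (hdist.comp hκm.tendsto_atTop))
  refine h1.congr fun n => ?_
  show dist ((T g).1 (φ (x (κ n)))) ((T g).1 (φ (x' (κ n)))) =
    ‖(T (UC.const X (e (κ n)))).1 (φ (x (κ n))) - (T (UC.const X (e' (κ n)))).1 (φ (x' (κ n)))‖
  rw [dist_eq_norm, hg1, hg2]

theorem PreservesSeparation.exists_representation [CompleteSpace X] [CompleteSpace Y]
    [NormedSpace ℝ F] [Nontrivial E] [Nontrivial F] {T : UC X E ≃ UC Y F}
    (hT : PreservesSeparation T) :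
    ∃ (φ : X ≃ᵤ Y) (Φ : Y × E → F) (Ψ : X × F → E), IsUAdmissible φ Φ Ψ ∧
      (∀ (f : UC X E) (y : Y), (T f).1 y = Φ (y, f.1 (φ.symm y))) ∧
      (∀ (g : UC Y F) (x : X), (T.symm g).1 x = Ψ (x, g.1 (φ x))) := by
  obtain ⟨φ, hφ⟩ := hT.exists_homeomorph
  have hφs : ∀ (f h : UC Y F) (y : Y), f.1 y = h.1 y ↔
      (T.symm f).1 (φ.symm y) = (T.symm h).1 (φ.symm y) := fun f h y => by rw [hφ]; simp
  have hu := uniformContinuous_of_forall_apply_eq_iff T φ hφ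
  have hus := uniformContinuous_of_forall_apply_eq_iff T.symm φ.symm hφs
  have hrep := apply_eq_const_apply T φ.toEquiv fun f h x => (hφ f h x).1
  have hreps := apply_eq_const_apply T.symm φ.symm.toEquiv fun f h x => (hφs f h x).1
  have hleft : ∀ (x : X) (e : E),
      (T.symm (UC.const Y ((T (UC.const X e)).1 (φ x)))).1 x = e := fun x e => by
    have := hreps (T (UC.const X e)) x
    rw [T.symm_apply_apply] at this
    exact this.symm
  have hright : ∀ (x : X) (v : F),
      (T (UC.const X ((T.symm (UC.const Y v)).1 x))).1 (φ x) = v := fun x v => by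
    have := hrep (T.symm (UC.const Y v)) (φ x)
    rw [T.apply_symm_apply, show φ.toEquiv.symm (φ x) = x from φ.symm_apply_apply x] at this
    exact this.symm
  refine ⟨⟨φ.toEquiv, hu, hus⟩, fun p => (T (UC.const X p.2)).1 p.1,
    fun p => (T.symm (UC.const Y p.2)).1 p.1, ?_, hrep, hreps⟩
  refine ⟨fun y => ?_, ?_, ?_, ?_, ?_, ?_, ?_⟩
  · obtain ⟨x, rfl⟩ := φ.surjective y
    exact Function.bijective_iff_has_inverse.2
      ⟨fun v => (T.symm (UC.const Y v)).1 x, hleft x, hright x⟩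
  · rintro x _ rfl e
    exact hleft x e
  · rintro x _ rfl v
    exact hright x v
  · exact fun y hy e => continuousAt_apply_const T φ (fun f h x => (hφ f h x).1) hy e
  · exact fun x hx v => continuousAt_apply_const T.symm φ.symm (fun f h x => (hφs f h x).1) hx v
  · exact isUContinuous_apply_const T φ hu fun f h x => (hφ f h x).1
  · exact isUContinuous_apply_const T.symm φ.symm hus fun f h x => (hφs f h x).1

end Representation

/-! ### From admissible data to a biseparating map. -/

section Converse

variable {X Y E F : Type*} [MetricSpace X] [MetricSpace Y]
  [NormedAddCommGroup E] [NormedAddCommGroup F]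

/-- A function oscillating by at most `1` at scale `ε` grows at most linearly along `ε`-chains. -/
theorem norm_sub_le_of_chain {f : X → E} {ε : ℝ} (hε : 0 < ε)
    (hf : ∀ a b, dist a b ≤ ε → ‖f a - f b‖ ≤ 1) (c : ℕ → X) (n : ℕ)
    (hc : ∀ i < n, dist (c i) (c (i + 1)) ≤ ε) :
    ‖f (c 0) - f (c n)‖ ≤ 2 / ε * ∑ i ∈ Finset.range n, dist (c i) (c (i + 1)) + 1 := by
  -- Short steps must not each cost `1`. So `p` is an earlier anchor and `L ≤ ε` the length not yet
  -- charged; when it would exceed `ε`, a cost of `2` is charged and the anchor moves on.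
  suffices h : ∃ (p : X) (L : ℝ), dist p (c n) ≤ L ∧ L ≤ ε ∧ ‖f (c 0) - f p‖ ≤
      2 / ε * (∑ i ∈ Finset.range n, dist (c i) (c (i + 1)) - L) by
    obtain ⟨p, L, h1, h2, h3⟩ := h
    have h4 := hf p (c n) (h1.trans h2)
    have h5 := norm_sub_le_norm_sub_add_norm_sub (f (c 0)) (f p) (f (c n))
    have h6 : 0 ≤ 2 / ε * L := mul_nonneg (by positivity) (dist_nonneg.trans h1)
    rw [mul_sub] at h3
    linarith
  induction n with
  | zero => exact ⟨c 0, 0, by simp, hε.le, by simp⟩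
  | succ n ih =>
    obtain ⟨p, L, h1, h2, h3⟩ := ih fun i hi => hc i (by omega)
    have hs := hc n (by omega)
    rw [Finset.sum_range_succ]
    by_cases hL : L + dist (c n) (c (n + 1)) ≤ ε
    · refine ⟨p, L + dist (c n) (c (n + 1)), (dist_triangle _ (c n) _).trans (by linarith), hL, ?_⟩
      rwa [add_sub_add_right_eq_sub]
    · refine ⟨c (n + 1), 0, by simp, hε.le, ?_⟩
      rw [not_le] at hL
      have h4 := hf p (c n) (h1.trans h2)
      have h5 := hf _ _ hs
      have h6 := norm_sub_le_norm_sub_add_norm_sub (f (c 0)) (f p) (f (c n))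
      have h7 := norm_sub_le_norm_sub_add_norm_sub (f (c 0)) (f (c n)) (f (c (n + 1)))
      have h8 : 2 ≤ 2 / ε * (L + dist (c n) (c (n + 1))) := by
        calc (2 : ℝ) = 2 / ε * ε := by field_simp
          _ ≤ _ := mul_le_mul_of_nonneg_left hL.le (by positivity)
      have e1 : 2 / ε * (∑ i ∈ Finset.range n, dist (c i) (c (i + 1)) +
          dist (c n) (c (n + 1)) - 0) =
          2 / ε * (∑ i ∈ Finset.range n, dist (c i) (c (i + 1)) - L) +
            2 / ε * (L + dist (c n) (c (n + 1))) := by ring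
      rw [e1]
      linarith

/-- Uniform continuity bounds growth along chains linearly up to an additive constant, which
separation absorbs. -/
theorem IsSeparatedSeq.isUSeq {x : ℕ → X} (hx : IsSeparatedSeq x) {f : X → E}
    (hf : UniformContinuous f) : IsUSeq x (f ∘ x) := by
  refine ⟨hx, ?_⟩
  obtain ⟨r, hr, hsep⟩ := hx
  obtain ⟨δ, hδ, hd⟩ := Metric.uniformContinuous_iff.1 hf 1 one_pos
  have hε : 0 < δ / 2 := by positivity
  have hf1 : ∀ a b, dist a b ≤ δ / 2 → ‖f a - f b‖ ≤ 1 := fun a b h => by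
    rw [← dist_eq_norm]
    exact (hd (by linarith)).le
  -- The summand `1 / r` pays for the additive `1`, as every chain between distinct terms has length
  -- at least `r`.
  have hC : 0 ≤ 2 / (δ / 2) + 1 / r := by positivity
  obtain ⟨K, hKe⟩ : ∃ K : ℝ≥0, (K : ℝ) = 2 / (δ / 2) + 1 / r := ⟨⟨_, hC⟩, rfl⟩
  refine ⟨δ / 2, hε, K, fun m n => ?_⟩
  by_cases hmn : m = n
  · subst hmn; simp
  have hK : K ≠ 0 := fun h => by
    rw [h, NNReal.coe_zero] at hKe
    have : 0 < 2 / (δ / 2) + 1 / r := by positivity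
    exact this.ne hKe
  rw [mul_comm, ← ENNReal.div_le_iff_le_mul (Or.inl (ENNReal.coe_ne_zero.2 hK))
    (Or.inl ENNReal.coe_ne_top)]
  refine le_iInf fun k => le_iInf fun c => le_iInf fun hc => ?_
  obtain ⟨h0, hk, hc⟩ := hc
  rw [ENNReal.div_le_iff_le_mul (Or.inl (ENNReal.coe_ne_zero.2 hK)) (Or.inl ENNReal.coe_ne_top)]
  have hsum : ∑ i ∈ Finset.range k, edist (c i) (c (i + 1)) =
      ENNReal.ofReal (∑ i ∈ Finset.range k, dist (c i) (c (i + 1))) := by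
    rw [ENNReal.ofReal_sum_of_nonneg fun _ _ => dist_nonneg]
    simp only [edist_dist]
  have h1 := norm_sub_le_of_chain hε hf1 c k hc
  have h2 := dist_le_range_sum_dist c k
  rw [h0, hk] at h1 h2
  have h3 := (hsep n m (Ne.symm hmn)).trans h2
  rw [hsum, ← ENNReal.ofReal_coe_nnreal, ← ENNReal.ofReal_mul (Finset.sum_nonneg fun _ _ =>
    dist_nonneg)]
  refine ENNReal.ofReal_le_ofReal (h1.trans ?_)
  have h4 : 1 ≤ 1 / r * ∑ i ∈ Finset.range k, dist (c i) (c (i + 1)) := by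
    rw [one_div_mul_eq_div]
    exact (one_le_div hr).2 h3
  rw [hKe, mul_add, mul_comm _ (1 / r), mul_comm _ (2 / (δ / 2))]
  linarith

theorem IsUContinuous.uniformContinuous_graph [CompleteSpace X] {Ξ : X × E → F}
    (hu : IsUContinuous Ξ)
    (hc : ∀ x ∈ derivedSet (Set.univ : Set X), ∀ e, ContinuousAt Ξ (x, e)) {f : X → E}
    (hf : UniformContinuous f) : UniformContinuous fun x => Ξ (x, f x) := by
  by_contra hnot
  obtain ⟨ε, hε, a, b, hab, hd⟩ := not_uniformContinuous_exists_seq hnot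
  have hne : ∀ n, a n ≠ b n := fun n h => by
    have := hd n
    rw [h, dist_self] at this
    linarith
  rcases exists_subseq_tendsto_or_separated a with ⟨x, σ, hσ, hlim⟩ | ⟨σ, hσ, hsep⟩
  · have hlim' : Tendsto (b ∘ σ) atTop (𝓝 x) :=
      (tendsto_iff_of_dist (hab.comp hσ.tendsto_atTop)).1 hlim
    -- Two sequences tending to `x` with `a n ≠ b n` for all `n` prevent `x` from being isolated.
    have hx : x ∈ derivedSet (Set.univ : Set X) := by
      rw [mem_derivedSet_univ_iff, ne_eq, ← isOpen_singleton_iff_punctured_nhds]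
      intro ho
      obtain ⟨n, h1, h2⟩ := ((hlim.eventually (ho.mem_nhds rfl)).and
        (hlim'.eventually (ho.mem_nhds rfl))).exists
      exact hne (σ n) (h1.trans h2.symm)
    have hg : ContinuousAt (fun x => Ξ (x, f x)) x :=
      ContinuousAt.comp (f := fun x => (x, f x)) (hc x hx (f x))
        (continuousAt_id.prodMk hf.continuous.continuousAt)
    have h1 := (hg.tendsto.comp hlim).dist (hg.tendsto.comp hlim')
    rw [dist_self] at h1
    obtain ⟨n, hn⟩ := (h1.eventually_lt_const hε).exists
    exact absurd (hd (σ n)) (not_le.2 hn)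
  · have h1 := hu (a ∘ σ) (f ∘ a ∘ σ) (hsep.isUSeq hf) (b ∘ σ) (f ∘ b ∘ σ) (fun n => hne _) (by
      have h2 := hab.comp hσ.tendsto_atTop
      have h3 := h2.add (tendsto_dist_zero_of_uniformContinuous hf h2)
      rw [add_zero] at h3
      refine h3.congr fun n => ?_
      simp [dist_eq_norm])
    obtain ⟨n, hn⟩ := (h1.eventually_lt_const hε).exists
    rw [← dist_eq_norm] at hn
    exact absurd (hd (σ n)) (not_le.2 hn)

theorem IsUAdmissible.exists_isBiseparating [CompleteSpace X] [CompleteSpace Y] {φ : X ≃ᵤ Y}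
    {Φ : Y × E → F} {Ψ : X × F → E} (h : IsUAdmissible φ Φ Ψ) :
    ∃ T : UC X E → UC Y F, (∀ (f : UC X E) (y : Y), (T f).1 y = Φ (y, f.1 (φ.symm y))) ∧
      IsBiseparating T := by
  have h1 : ∀ f : UC X E, UniformContinuous fun x => Φ (φ x, f.1 x) := fun f =>
    h.uContinuous.uniformContinuous_graph (Ξ := fun p => Φ (φ p.1, p.2)) (fun x hx e =>
      ContinuousAt.comp (f := fun p : X × E => (φ p.1, p.2))
        (h.continuousAt (φ x) (homeomorph_apply_mem_derivedSet_univ φ.toHomeomorph hx) e)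
        ((φ.continuous.comp continuous_fst).prodMk continuous_snd).continuousAt) f.2
  have h2 : ∀ g : UC Y F, UniformContinuous fun y => Ψ (φ.symm y, g.1 y) := fun g =>
    h.uContinuous_inv.uniformContinuous_graph (Ξ := fun p => Ψ (φ.symm p.1, p.2)) (fun y hy v =>
      ContinuousAt.comp (f := fun p : Y × F => (φ.symm p.1, p.2))
        (h.continuousAt_inv (φ.symm y) (homeomorph_apply_mem_derivedSet_univ φ.symm.toHomeomorph hy) v)
        ((φ.symm.continuous.comp continuous_fst).prodMk continuous_snd).continuousAt) g.2
  have hinj : ∀ (y : Y) (e e' : E), Φ (y, e) = Φ (y, e') ↔ e = e' := fun y _ _ =>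
    (h.bijective y).1.eq_iff
  refine ⟨fun f => ⟨fun y => Φ (y, f.1 (φ.symm y)), ?_⟩, fun _ _ => rfl, ⟨?_, ?_⟩, ?_⟩
  · have := (h1 f).comp φ.symm.uniformContinuous
    simp only [Function.comp_def, UniformEquiv.apply_symm_apply] at this
    exact this
  · intro f g hfg
    refine Subtype.ext (funext fun x => ?_)
    have := congrFun (congrArg Subtype.val hfg) (φ x)
    simpa [hinj] using this
  · intro g
    refine ⟨⟨fun x => Ψ (x, g.1 (φ x)), ?_⟩, Subtype.ext (funext fun y => ?_)⟩
    · have := (h2 g).comp φ.uniformContinuous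
      simp only [Function.comp_def, UniformEquiv.symm_apply_apply] at this
      exact this
    · simp only [UniformEquiv.apply_symm_apply]
      exact h.rightInverse _ _ (φ.apply_symm_apply y) _
  · intro f g k
    rw [disjointWrt_iff_forall, disjointWrt_iff_forall]
    refine ⟨fun H y => (H (φ.symm y)).imp (hinj y _ _).2 (hinj y _ _).2, fun H x => ?_⟩
    have := (H (φ x)).imp (hinj _ _ _).1 (hinj _ _ _).1
    rwa [φ.symm_apply_apply] at this

end Converse

/-! ### Both directions together. -/

theorem theorem7p8 {𝕜 𝕜' : Type*} [RCLike 𝕜] [RCLike 𝕜']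
    {X Y E F : Type*} [MetricSpace X] [CompleteSpace X] [MetricSpace Y] [CompleteSpace Y]
    [NormedAddCommGroup E] [NormedSpace 𝕜 E] [CompleteSpace E] [Nontrivial E]
    [NormedAddCommGroup F] [NormedSpace 𝕜' F] [CompleteSpace F] [Nontrivial F] :
    (∀ (T : UC X E → UC Y F) (hT : IsBiseparating T),
      ∃ (φ : X ≃ᵤ Y) (Φ : Y × E → F) (Ψ : X × F → E),
        IsUAdmissible φ Φ Ψ ∧
        (∀ (f : UC X E) (y : Y), (T f : Y → F) y = Φ (y, (f : X → E) (φ.symm y))) ∧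
        (∀ (g : UC Y F) (x : X),
          ((Equiv.ofBijective T hT.bijective).symm g : X → E) x =
            Ψ (x, (g : Y → F) (φ x)))) ∧
    (∀ (φ : X ≃ᵤ Y) (Φ : Y × E → F) (Ψ : X × F → E), IsUAdmissible φ Φ Ψ →
      ∃ T : UC X E → UC Y F,
        (∀ (f : UC X E) (y : Y), (T f : Y → F) y = Φ (y, (f : X → E) (φ.symm y))) ∧
        IsBiseparating T) := by
  -- All cut-offs are real-valued, so real scalars suffice for both fields.
  let _ : NormedSpace ℝ E := NormedSpace.restrictScalars ℝ 𝕜 E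
  let _ : NormedSpace ℝ F := NormedSpace.restrictScalars ℝ 𝕜' F
  refine ⟨fun T hT => ?_, fun φ Φ Ψ h => h.exists_isBiseparating⟩
  have hT' : PreservesSeparation (Equiv.ofBijective T hT.bijective) := fun f g h => by
    rw [← disjointWrt_iff_forall, ← disjointWrt_iff_forall]
    exact hT.disjointWrt_iff f g h
  exact hT'.exists_representation
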